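/- Let $X,X_1,X_2,Y,Y_1,Y_2$ be random variables on a common probability space, taking values in finite sets $\mathcal X,\mathcal X_1,\mathcal X_2,\mathcal Y,\mathcal Y_1,\mathcal Y_2$. For probability mass functions (PMFs) $P,Q$ on a finite set, let $D(P\|Q)=\sum_x P(x)\log\frac{P(x)}{Q(x)}$ (with $0\log\frac0q=0$ for all $q\ge 0$, and $p\log\frac p0=\infty$ for $p>0$), and for $\alpha>0$, $\alpha\neq1$, let $$\Delta_\alpha(P\|Q)=\frac{\alpha}{1-\alpha}\log\sum_x P(x)Q(x)^{\alpha-1}+\log\sum_x Q(x)^\alpha-\frac1{1-\alpha}\log\sum_x P(x)^\alpha ,$$ where for $\alpha<1$ the term $P(x)Q(x)^{\alpha-1}$ is read as $P(x)/Q(x)^{1-\alpha}$ with $\frac00=0$ and $\frac p0=\infty$ for $p>0$, and where $\log 0=-\infty$, $\log\infty=\infty$; let $\Delta_1(P\|Q)=D(P\|Q)$. Define $$K_\alpha(X;Y)=\min_{Q_X,Q_Y}\Delta_\alpha(P_{XY}\|Q_XQ_Y),$$ the minimum being over all PMFs $Q_X$ on $\mathcal X$ and $Q_Y$ on $\mathcal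 Y$, where $P_{XY}$ is the joint PMF of $(X,Y)$. Let $I(X;Y)=D(P_{XY}\|P_XP_Y)$, let $H_\alpha(X)=\frac1{1-\alpha}\log\sum_xP_X(x)^\alpha$ for $\alpha>0$, $\alpha\ne1$, let $H_1(X)=\sum_xP_X(x)\log\frac1{P_X(x)}$ and $H_\infty(X)=-\log\max_xP_X(x)$. Then for every $\alpha>0$ the minimum defining $K_\alpha(X;Y)$ is attained, and: 1. $K_\alpha(X;Y)\ge0$, with equality if and only if $X$ and $Y$ are independent. 2. $K_\alpha(X;Y)=K_\alpha(Y;X)$. 3. If the pairs $(X_1,Y_1)$ and $(X_2,Y_2)$ are independent, then $K_\alpha(X_1,X_2;Y_1,Y_2)=K_\alpha(X_1;Y_1)+K_\alpha(X_2;Y_2)$. 4. $K_\alpha(X;Y)\le\log|\mathcal X|$ and $K_\alpha(X;Y)\le\log|\mathcal Y|$. In addition: 5. $K_1(X;Y)=I(X;Y)$. 6. $\alpha\mapsto K_\alpha(X;Y)$ is continuous on $(0,\infty)$. 7. $K_\alpha(X;X)=2H_{\frac{\alpha}{2-\alpha}}(X)-H_\alpha(X)$ for $\alpha\in(0,2)$,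 and $K_\alpha(X;X)=\frac{\alpha}{\alpha-1}H_\infty(X)-H_\alpha(X)$ for $\alpha\ge2$. -/

import Mathlib

open MeasureTheory ProbabilityTheory
open scoped ENNReal

namespace RelAlpha

/-- The probability mass function `z ↦ Pr[Z = z]` of a random variable `Z`, with values in
`[0, ∞]` so that it can be used in the extended-valued divergences below. -/
noncomputable def pmfOf {Ω ι : Type*} [MeasurableSpace Ω] (μ : Measure Ω) (Z : Ω → ι) : ι → ℝ≥0∞ :=
  fun z => μ (Z ⁻¹' {z})

/-- Product `(x, y) ↦ p x * q y` of two mass functions. -/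
noncomputable def prodPmf {ι κ : Type*} (p : ι → ℝ≥0∞) (q : κ → ℝ≥0∞) : ι × κ → ℝ≥0∞ :=
  fun z => p z.1 * q z.2

/-- Relative entropy `D(P‖Q) = ∑ P log (P / Q)` of mass functions on a finite set.
The arithmetic of `ℝ≥0∞` and `EReal` gives exactly the conventions
`0 log (0 / q) = 0` (also for `q = 0`) and `p log (p / 0) = ∞` for `p > 0`. -/
noncomputable def relEntropy {ι : Type*} [Fintype ι] (P Q : ι → ℝ≥0∞) : EReal :=
  ∑ x, (P x : EReal) * ENNReal.log (P x / Q x)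

/-- Relative `α`-entropy `Δ_α(P‖Q)` of mass functions on a finite set, for `α > 0`; at `α = 1` it
is the relative entropy. In `ℝ≥0∞`, for `α < 1`, the product `P x * Q x ^ (α - 1)` is `0` if
`P x = 0` and `∞` if `P x > 0 = Q x`; `ENNReal.log 0 = -∞` and `ENNReal.log ∞ = ∞`.
For probability mass functions the last two summands are finite. -/
noncomputable def relAlphaEntropy {ι : Type*} [Fintype ι] (α : ℝ) (P Q : ι → ℝ≥0∞) : EReal :=
  if α = 1 then relEntropy P Q
  else ((α / (1 - α) : ℝ) : EReal) * ENNReal.log (∑ x, P x * Q x ^ (α - 1))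
    + ENNReal.log (∑ x, Q x ^ α)
    - ((1 / (1 - α) : ℝ) : EReal) * ENNReal.log (∑ x, P x ^ α)

/-- `K_α(X;Y)`: the minimum of `Δ_α(P_XY‖Q_X Q_Y)` over all probability mass functions
`Q_X` and `Q_Y`, written as an infimum. -/
noncomputable def K {Ω 𝒳 𝒴 : Type*} [MeasurableSpace Ω] [Fintype 𝒳] [Fintype 𝒴]
    (μ : Measure Ω) (α : ℝ) (X : Ω → 𝒳) (Y : Ω → 𝒴) : EReal :=
  ⨅ (QX : PMF 𝒳) (QY : PMF 𝒴),
    relAlphaEntropy α (pmfOf μ (fun ω => (X ω, Y ω))) (prodPmf QX QY)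

/-- Mutual information `I(X;Y) = D(P_XY‖P_X P_Y)`. -/
noncomputable def mutualInfo {Ω 𝒳 𝒴 : Type*} [MeasurableSpace Ω] [Fintype 𝒳] [Fintype 𝒴]
    (μ : Measure Ω) (X : Ω → 𝒳) (Y : Ω → 𝒴) : EReal :=
  relEntropy (pmfOf μ (fun ω => (X ω, Y ω))) (prodPmf (pmfOf μ X) (pmfOf μ Y))

/-- Rényi entropy `H_α(X)` of order `α > 0`; at `α = 1` it is the Shannon entropy. -/
noncomputable def renyiEntropy {Ω 𝒳 : Type*} [MeasurableSpace Ω] [Fintype 𝒳]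
    (μ : Measure Ω) (α : ℝ) (X : Ω → 𝒳) : ℝ :=
  if α = 1 then ∑ x, (pmfOf μ X x).toReal * Real.log (1 / (pmfOf μ X x).toReal)
  else 1 / (1 - α) * Real.log (∑ x, (pmfOf μ X x).toReal ^ α)

/-- Rényi entropy of order infinity, `H_∞(X) = -log max_x P_X(x)`. -/
noncomputable def minEntropy {Ω 𝒳 : Type*} [MeasurableSpace Ω]
    (μ : Measure Ω) (X : Ω → 𝒳) : ℝ :=
  -Real.log (⨆ x, (pmfOf μ X x).toReal)

end RelAlpha

namespace RelAlpha

open Filter Topology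

/-! ### Inequalities for power moments of mass functions. -/

section RealInequalities

variable {ι : Type*} [Fintype ι]

/-! For `α ≠ 1` put `s = (α - 1) / α` and substitute `Q = escort (1 / α) T`, that is, `T`
proportional to `Q ^ α`. The normalising constants cancel and `Δ_α(P‖Q) = -(1/s) log ∑ P T ^ s -
H_α(P)` (`relAlphaEntropy_escort`). Escorts of orders `α` and `1 / α` are mutually inverse and
respect products, so minimising over products `Q_X Q_Y` is the same as minimising over products `T =
r t`. A bound `c ≤ K_α` thus becomes a bound on the moments `∑ P (r t) ^ s`: from above if `α > 1`
(`s > 0`), from below if `α < 1` (`s < 0`); see `le_minDiv_iff_of_one_lt` and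
`le_minDiv_iff_of_lt_one`.

Nonnegativity and its equality case are Hölder's inequality for these moments, proved by weighted
AM-GM. The moment is homogeneous in `r` and in `t`, so for a tensor product one pair can be bounded
slice by slice and then the other, which gives additivity. The cardinality bound comes from testing
a uniform `r`. On the diagonal only `w = √(r t)` matters, with exponent `2 s`; this is a
one-variable Hölder problem of order `α / (2 - α)` when `α < 2`, while for `α ≥ 2` a point mass is
optimal.

Attainment and continuity away from order one follow from compactness of the simplices and joint
continuity of the extended-valued objective. At order one Gibbs' inequality identifies the minimiser
as the product of the marginals. Continuity there is a squeeze: the marginals give the upper bound,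
Jensen (`α < 1`) and Cauchy-Schwarz (`α > 1`) the lower ones. Additivity, the cardinality bound and
the diagonal formula at order one are then limits. -/

theorem sum_rpow_mul_rpow_le_one {s : ℝ} (hs0 : 0 < s) (hs1 : s < 1) {u v : ι → ℝ}
    (hu : ∀ i, 0 ≤ u i) (hu1 : ∑ i, u i ≤ 1) (hv : ∀ i, 0 ≤ v i) (hv1 : ∑ i, v i ≤ 1) :
    ∑ i, u i ^ (1 - s) * v i ^ s ≤ 1 := by
  calc ∑ i, u i ^ (1 - s) * v i ^ s ≤ ∑ i, ((1 - s) * u i + s * v i) :=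
        Finset.sum_le_sum fun i _ => Real.geom_mean_le_arith_mean2_weighted (by linarith) hs0.le
          (hu i) (hv i) (by ring)
    _ = (1 - s) * ∑ i, u i + s * ∑ i, v i := by
        rw [Finset.sum_add_distrib, Finset.mul_sum, Finset.mul_sum]
    _ ≤ 1 := by nlinarith

theorem eq_of_sum_rpow_mul_rpow_eq_one {s : ℝ} (hs0 : 0 < s) (hs1 : s < 1) {u v : ι → ℝ}
    (hu : u ∈ stdSimplex ℝ ι) (hv : v ∈ stdSimplex ℝ ι)
    (h : ∑ i, u i ^ (1 - s) * v i ^ s = 1) : u = v := by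
  have hle : ∀ i ∈ Finset.univ, u i ^ (1 - s) * v i ^ s ≤ (1 - s) * u i + s * v i := fun i _ =>
    Real.geom_mean_le_arith_mean2_weighted (by linarith) hs0.le (hu.1 i) (hv.1 i) (by ring)
  have hsum : ∑ i, u i ^ (1 - s) * v i ^ s = ∑ i, ((1 - s) * u i + s * v i) := by
    rw [h, Finset.sum_add_distrib, ← Finset.mul_sum, ← Finset.mul_sum, hu.2, hv.2]; ring
  rw [Finset.sum_eq_sum_iff_of_le hle] at hsum
  funext i
  exact (Real.geom_mean_eq_arith_mean2_weighted_iff_of_pos (by linarith) hs0 (hu.1 i) (hv.1 i)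
    (by ring)).1 (hsum i (Finset.mem_univ i))

/-- AM-GM reverses for a negative weight: with `x = v / u` it reads `exp (s log x) ≥ 1 + s log x ≥ 1
+ s (x - 1)`, and the last step is strict unless `x = 1`. The support condition is essential, since
the real power `0 ^ s` is `0` rather than infinite. -/
theorem rpow_mul_rpow_of_neg_ge {s u v : ℝ} (hs : s < 0) (hu : 0 ≤ u) (hv : 0 ≤ v)
    (h : u ≠ 0 → v ≠ 0) :
    (1 - s) * u + s * v ≤ u ^ (1 - s) * v ^ s ∧
      (u ^ (1 - s) * v ^ s = (1 - s) * u + s * v → u = v) := by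
  rcases hu.eq_or_lt with rfl | hu
  · rw [Real.zero_rpow (by linarith)]
    constructor
    · nlinarith
    · intro h'
      have : s * v = 0 := by linarith
      rcases mul_eq_zero.1 this with h | h
      · linarith
      · exact h.symm
  · have hv : 0 < v := lt_of_le_of_ne hv (h hu.ne').symm
    have hx : 0 < v / u := div_pos hv hu
    have e : u ^ (1 - s) * v ^ s = u * Real.exp (s * Real.log (v / u)) := by
      rw [mul_comm s, ← Real.rpow_def_of_pos hx, Real.div_rpow hv.le hu.le, Real.rpow_sub hu,
        Real.rpow_one]
      ring
    have e2 : (1 - s) * u + s * v = u * (1 + s * (v / u - 1)) := by field_simp; ring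
    rw [e, e2]
    have h1 := Real.add_one_le_exp (s * Real.log (v / u))
    have h2 : s * (v / u - 1) ≤ s * Real.log (v / u) :=
      mul_le_mul_of_nonpos_left (Real.log_le_sub_one_of_pos hx) hs.le
    refine ⟨mul_le_mul_of_nonneg_left (by linarith) hu.le, fun h' => ?_⟩
    have h3 := mul_left_cancel₀ hu.ne' h'
    by_contra hne
    have hne' : v / u ≠ 1 := fun h => hne ((div_eq_one_iff_eq hu.ne').1 h).symm
    have := mul_lt_mul_of_neg_left (Real.log_lt_sub_one_of_pos hx hne') hs
    linarith

theorem one_le_sum_rpow_mul_rpow {s : ℝ} (hs : s < 0) {u v : ι → ℝ}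
    (hu : u ∈ stdSimplex ℝ ι) (hv : ∀ i, 0 ≤ v i) (hv1 : ∑ i, v i ≤ 1)
    (h : ∀ i, u i ≠ 0 → v i ≠ 0) :
    1 ≤ ∑ i, u i ^ (1 - s) * v i ^ s := by
  calc 1 ≤ (1 - s) * ∑ i, u i + s * ∑ i, v i := by rw [hu.2]; nlinarith
    _ = ∑ i, ((1 - s) * u i + s * v i) := by
        rw [Finset.sum_add_distrib, Finset.mul_sum, Finset.mul_sum]
    _ ≤ _ := Finset.sum_le_sum fun i _ => (rpow_mul_rpow_of_neg_ge hs (hu.1 i) (hv i) (h i)).1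

theorem eq_of_sum_rpow_mul_rpow_eq_one_of_neg {s : ℝ} (hs : s < 0) {u v : ι → ℝ}
    (hu : u ∈ stdSimplex ℝ ι) (hv : v ∈ stdSimplex ℝ ι) (hac : ∀ i, u i ≠ 0 → v i ≠ 0)
    (h : ∑ i, u i ^ (1 - s) * v i ^ s = 1) : u = v := by
  have hle : ∀ i ∈ Finset.univ, (1 - s) * u i + s * v i ≤ u i ^ (1 - s) * v i ^ s := fun i _ =>
    (rpow_mul_rpow_of_neg_ge hs (hu.1 i) (hv.1 i) (hac i)).1
  have hsum : ∑ i, ((1 - s) * u i + s * v i) = ∑ i, u i ^ (1 - s) * v i ^ s := by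
    rw [h, Finset.sum_add_distrib, ← Finset.mul_sum, ← Finset.mul_sum, hu.2, hv.2]; ring
  rw [Finset.sum_eq_sum_iff_of_le hle] at hsum
  funext i
  exact (rpow_mul_rpow_of_neg_ge hs (hu.1 i) (hv.1 i) (hac i)).2 (hsum i (Finset.mem_univ i)).symm

/-- The escort mass function of order `a`, proportional to `p ^ a`. -/
noncomputable def escort (a : ℝ) (p : ι → ℝ) : ι → ℝ := fun i => p i ^ a / ∑ j, p j ^ a

theorem exists_pos_of_mem_stdSimplex {p : ι → ℝ} (hp : p ∈ stdSimplex ℝ ι) : ∃ i, 0 < p i := by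
  by_contra! h
  have := Finset.sum_nonpos fun i (_ : i ∈ Finset.univ) => h i
  rw [hp.2] at this
  linarith

theorem sum_rpow_pos {p : ι → ℝ} (hp : p ∈ stdSimplex ℝ ι) (a : ℝ) : 0 < ∑ i, p i ^ a := by
  obtain ⟨i, hi⟩ := exists_pos_of_mem_stdSimplex hp
  exact Finset.sum_pos' (fun j _ => Real.rpow_nonneg (hp.1 j) a)
    ⟨i, Finset.mem_univ i, Real.rpow_pos_of_pos hi a⟩

theorem escort_mem {a : ℝ} {p : ι → ℝ} (hp : p ∈ stdSimplex ℝ ι) :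
    escort a p ∈ stdSimplex ℝ ι :=
  ⟨fun i => div_nonneg (Real.rpow_nonneg (hp.1 i) a) (sum_rpow_pos hp a).le, by
    simp only [escort]
    rw [← Finset.sum_div, div_self (sum_rpow_pos hp a).ne']⟩

theorem escort_ne_zero_iff {a : ℝ} (ha : a ≠ 0) {p : ι → ℝ} (hp : p ∈ stdSimplex ℝ ι) (i : ι) :
    escort a p i ≠ 0 ↔ p i ≠ 0 := by
  simp only [escort, ne_eq, div_eq_zero_iff, (sum_rpow_pos hp a).ne', or_false,
    Real.rpow_eq_zero (hp.1 i) ha]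

/-- Makes `T ↦ escort (1 / α) T` a bijection of the simplex, with inverse `escort α`; this justifies
the change of variables. -/
theorem escort_escort {a b : ℝ} (hab : a * b = 1) {p : ι → ℝ} (hp : p ∈ stdSimplex ℝ ι) :
    escort b (escort a p) = p := by
  have hC := sum_rpow_pos hp a
  have h : ∀ i, escort a p i ^ b = p i / (∑ j, p j ^ a) ^ b := fun i => by
    rw [escort, Real.div_rpow (Real.rpow_nonneg (hp.1 i) a) hC.le, ← Real.rpow_mul (hp.1 i), hab,
      Real.rpow_one]
  funext i
  have : escort b (escort a p) i = escort a p i ^ b / ∑ j, escort a p j ^ b := rfl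
  rw [this]
  simp_rw [h]
  rw [← Finset.sum_div, hp.2]
  have := (Real.rpow_pos_of_pos hC b).ne'
  field_simp

theorem prod_mem {κ : Type*} [Fintype κ] {r : ι → ℝ} {t : κ → ℝ} (hr : r ∈ stdSimplex ℝ ι)
    (ht : t ∈ stdSimplex ℝ κ) : (fun z : ι × κ => r z.1 * t z.2) ∈ stdSimplex ℝ (ι × κ) :=
  ⟨fun z => mul_nonneg (hr.1 z.1) (ht.1 z.2), by
    rw [Fintype.sum_prod_type, ← Finset.sum_mul_sum, hr.2, ht.2, one_mul]⟩

theorem escort_prod {κ : Type*} [Fintype κ] (a : ℝ) {r : ι → ℝ} {t : κ → ℝ}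
    (hr : ∀ i, 0 ≤ r i) (ht : ∀ i, 0 ≤ t i) :
    escort a (fun z : ι × κ => r z.1 * t z.2) = fun z => escort a r z.1 * escort a t z.2 := by
  funext z
  simp only [escort]
  rw [div_mul_div_comm, ← Real.mul_rpow (hr _) (ht _), Finset.sum_mul_sum, Fintype.sum_prod_type]
  congr 1
  exact Finset.sum_congr rfl fun i _ => Finset.sum_congr rfl fun j _ =>
    Real.mul_rpow (hr _) (ht _)

/-- Weighted moment as a Hellinger-type sum with the escort mass function. -/
theorem sum_mul_rpow_eq_escort {s : ℝ} (hs : s < 1) {p T : ι → ℝ} (hp : p ∈ stdSimplex ℝ ι) :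
    ∑ i, p i * T i ^ s = (∑ i, p i ^ (1 / (1 - s))) ^ (1 - s) *
      ∑ i, escort (1 / (1 - s)) p i ^ (1 - s) * T i ^ s := by
  have hC := sum_rpow_pos hp (1 / (1 - s))
  have h1 : 1 / (1 - s) * (1 - s) = 1 := by
    have : 1 - s ≠ 0 := by linarith
    field_simp
  rw [Finset.mul_sum]
  refine Finset.sum_congr rfl fun i _ => ?_
  rw [escort, Real.div_rpow (Real.rpow_nonneg (hp.1 i) _) hC.le, ← Real.rpow_mul (hp.1 i), h1,
    Real.rpow_one]
  have := (Real.rpow_pos_of_pos hC (1 - s)).ne'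
  field_simp

/-- Hölder's inequality: up to a constant, `p` is the power `1 - s` of its escort, and AM-GM bounds
the remaining sum. Total mass below one is allowed because `√(r t)` is used as `T` in the diagonal
case. -/
theorem sum_mul_rpow_le {s : ℝ} (hs0 : 0 < s) (hs1 : s < 1) {p T : ι → ℝ}
    (hp : p ∈ stdSimplex ℝ ι) (hT : ∀ i, 0 ≤ T i) (hT1 : ∑ i, T i ≤ 1) :
    ∑ i, p i * T i ^ s ≤ (∑ i, p i ^ (1 / (1 - s))) ^ (1 - s) := by
  rw [sum_mul_rpow_eq_escort hs1 hp]
  exact mul_le_of_le_one_right (Real.rpow_nonneg (sum_rpow_pos hp _).le _)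
    (sum_rpow_mul_rpow_le_one hs0 hs1 (escort_mem hp).1 (escort_mem hp).2.le hT hT1)

theorem le_sum_mul_rpow {s : ℝ} (hs : s < 0) {p T : ι → ℝ}
    (hp : p ∈ stdSimplex ℝ ι) (hT : ∀ i, 0 ≤ T i) (hT1 : ∑ i, T i ≤ 1)
    (h : ∀ i, p i ≠ 0 → T i ≠ 0) :
    (∑ i, p i ^ (1 / (1 - s))) ^ (1 - s) ≤ ∑ i, p i * T i ^ s := by
  rw [sum_mul_rpow_eq_escort (by linarith : s < 1) hp]
  refine le_mul_of_one_le_right (Real.rpow_nonneg (sum_rpow_pos hp _).le _)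
    (one_le_sum_rpow_mul_rpow hs (escort_mem hp) hT hT1 fun i hi => h i ?_)
  rwa [escort_ne_zero_iff (one_div_ne_zero (by linarith)) hp] at hi

/-- The escort mass function attains the bounds of `sum_mul_rpow_le` and `le_sum_mul_rpow`. -/
theorem sum_mul_escort_rpow {s : ℝ} (hs : s < 1) {p : ι → ℝ} (hp : p ∈ stdSimplex ℝ ι) :
    ∑ i, p i * escort (1 / (1 - s)) p i ^ s = (∑ i, p i ^ (1 / (1 - s))) ^ (1 - s) := by
  rw [sum_mul_rpow_eq_escort hs hp]
  have : ∀ i, escort (1 / (1 - s)) p i ^ (1 - s) * escort (1 / (1 - s)) p i ^ s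
      = escort (1 / (1 - s)) p i := fun i => by
    -- The exponents add up to `1 ≠ 0`, so the addition rule survives at base zero.
    rw [← Real.rpow_add' ((escort_mem hp).1 i) (by simp)]
    simp
  simp_rw [this, (escort_mem hp).2, mul_one]

/-- Gibbs' inequality, with its equality case. -/
theorem gibbs {u v : ι → ℝ} (hu : u ∈ stdSimplex ℝ ι) (hv : v ∈ stdSimplex ℝ ι)
    (hac : ∀ i, u i ≠ 0 → v i ≠ 0) :
    ∑ i, u i * Real.log (v i) ≤ ∑ i, u i * Real.log (u i) ∧
      (∑ i, u i * Real.log (v i) = ∑ i, u i * Real.log (u i) → u = v) := by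
  -- Termwise form of `log x ≤ x - 1` at `x = v i / u i`; the right-hand sides sum to zero.
  have key : ∀ i, u i * Real.log (v i) - u i * Real.log (u i) ≤ v i - u i ∧
      (u i * Real.log (v i) - u i * Real.log (u i) = v i - u i → u i = v i) := fun i => by
    rcases (hu.1 i).eq_or_lt with h0 | hpos
    · rw [← h0]
      exact ⟨by simpa using hv.1 i, by simp⟩
    · have hvp : 0 < v i := lt_of_le_of_ne (hv.1 i) (hac i hpos.ne').symm
      have hx : 0 < v i / u i := div_pos hvp hpos
      have e1 : u i * Real.log (v i) - u i * Real.log (u i) = u i * Real.log (v i / u i) := by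
        rw [Real.log_div hvp.ne' hpos.ne']; ring
      have e2 : v i - u i = u i * (v i / u i - 1) := by field_simp
      rw [e1, e2]
      refine ⟨mul_le_mul_of_nonneg_left (Real.log_le_sub_one_of_pos hx) hpos.le, fun h => ?_⟩
      by_contra hne
      have hne' : v i / u i ≠ 1 := fun h => hne ((div_eq_one_iff_eq hpos.ne').1 h).symm
      exact (Real.log_lt_sub_one_of_pos hx hne').ne (mul_left_cancel₀ hpos.ne' h)
  have hz : ∑ i, (v i - u i) = 0 := by rw [Finset.sum_sub_distrib, hu.2, hv.2, sub_self]
  constructor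
  · rw [← sub_nonpos, ← Finset.sum_sub_distrib, ← hz]
    exact Finset.sum_le_sum fun i _ => (key i).1
  · intro h
    have h' : ∑ i, (u i * Real.log (v i) - u i * Real.log (u i)) = ∑ i, (v i - u i) := by
      rw [hz, Finset.sum_sub_distrib, h, sub_self]
    rw [Finset.sum_eq_sum_iff_of_le fun i _ => (key i).1] at h'
    exact funext fun i => (key i).2 (h' i (Finset.mem_univ i))

/-- Lower Jensen bound for moments of an arbitrary order. -/
theorem exp_mul_sum_log_le_sum_mul_rpow {p T : ι → ℝ} (hp : p ∈ stdSimplex ℝ ι)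
    (hT : ∀ i, 0 ≤ T i) (h : ∀ i, p i ≠ 0 → T i ≠ 0) (s : ℝ) :
    Real.exp (s * ∑ i, p i * Real.log (T i)) ≤ ∑ i, p i * T i ^ s := by
  set m := ∑ i, p i * Real.log (T i) with hm
  -- Tangent line of the exponential at `s * m`; its linear part averages to zero because `m` is the
  -- `p`-mean of `log T`.
  have key : ∀ i, p i * (Real.exp (s * m) * (1 + (s * Real.log (T i) - s * m)))
      ≤ p i * T i ^ s := fun i => by
    rcases (hp.1 i).eq_or_lt with h0 | hpos
    · simp [← h0]
    · have hTp : 0 < T i := lt_of_le_of_ne (hT i) (h i hpos.ne').symm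
      refine mul_le_mul_of_nonneg_left ?_ hpos.le
      have h1 := Real.add_one_le_exp (s * Real.log (T i) - s * m)
      calc Real.exp (s * m) * (1 + (s * Real.log (T i) - s * m))
          ≤ Real.exp (s * m) * Real.exp (s * Real.log (T i) - s * m) :=
            mul_le_mul_of_nonneg_left (by linarith) (Real.exp_pos _).le
        _ = T i ^ s := by rw [← Real.exp_add, Real.rpow_def_of_pos hTp]; congr 1; ring
  calc Real.exp (s * m) = ∑ i, p i * (Real.exp (s * m) * (1 + (s * Real.log (T i) - s * m))) := by
        have : ∀ i, p i * (Real.exp (s * m) * (1 + (s * Real.log (T i) - s * m)))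
            = Real.exp (s * m) * (1 - s * m) * p i
              + Real.exp (s * m) * s * (p i * Real.log (T i)) := fun i => by ring
        simp_rw [this]
        rw [Finset.sum_add_distrib, ← Finset.mul_sum, ← Finset.mul_sum, hp.2, ← hm]
        ring
    _ ≤ _ := Finset.sum_le_sum fun i _ => key i

/-- The slope at zero of the logarithm of the moments of `T`. -/
theorem tendsto_log_sum_mul_rpow {p T : ι → ℝ} (hp : p ∈ stdSimplex ℝ ι)
    (hT : ∀ i, 0 ≤ T i) (h : ∀ i, p i ≠ 0 → T i ≠ 0) :
    Tendsto (fun s : ℝ => s⁻¹ * Real.log (∑ i, p i * T i ^ s)) (𝓝[≠] 0)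
      (𝓝 (∑ i, p i * Real.log (T i))) := by
  have hd : HasDerivAt (fun s : ℝ => ∑ i, p i * T i ^ s) (∑ i, p i * Real.log (T i)) 0 := by
    refine HasDerivAt.fun_sum fun i _ => ?_
    rcases eq_or_ne (p i) 0 with h0 | h0
    · simpa [h0] using hasDerivAt_const (0 : ℝ) (0 : ℝ)
    · have hTp : 0 < T i := lt_of_le_of_ne (hT i) (h i h0).symm
      have := ((Real.hasStrictDerivAt_const_rpow hTp 0).hasDerivAt).const_mul (p i)
      simpa using this
  have h0 : ∑ i, p i * T i ^ (0 : ℝ) = 1 := by simp [hp.2]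
  have hl := hd.log (by rw [h0]; exact one_ne_zero)
  rw [hasDerivAt_iff_tendsto_slope_zero] at hl
  simpa [h0, hp.2] using hl

end RealInequalities

/-! ### Divergences of real mass functions and the escort change of variables. -/

section Divergences

variable {ι κ : Type*} [Fintype ι] [Fintype κ]

/-- A real mass function, viewed with values in `[0, ∞]`. -/
noncomputable def lift (p : ι → ℝ) : ι → ℝ≥0∞ := fun i => ENNReal.ofReal (p i)

/-- Rényi entropy of a real mass function. -/
noncomputable def entropy (α : ℝ) (p : ι → ℝ) : ℝ :=
  if α = 1 then ∑ i, p i * Real.log (1 / p i) else 1 / (1 - α) * Real.log (∑ i, p i ^ α)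

theorem entropy_of_ne {α : ℝ} (hα : α ≠ 1) (p : ι → ℝ) :
    entropy α p = 1 / (1 - α) * Real.log (∑ i, p i ^ α) := if_neg hα

theorem entropy_one (p : ι → ℝ) : entropy 1 p = -∑ i, p i * Real.log (p i) := by
  simp [entropy]

omit [Fintype ι] [Fintype κ] in
theorem prodPmf_lift {p : ι → ℝ} (hp : ∀ i, 0 ≤ p i) (q : κ → ℝ) :
    prodPmf (lift p) (lift q) = lift (fun z : ι × κ => p z.1 * q z.2) :=
  funext fun z => (ENNReal.ofReal_mul (hp z.1)).symm

-- Real and extended powers differ only at base `0` with negative exponent (`0` against `∞`); the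
-- hypothesis excludes this or supplies the factor `P i = 0`.
omit [Fintype ι] in
theorem lift_mul_rpow {P Q : ι → ℝ} {a : ℝ} (hP : ∀ i, 0 ≤ P i) (hQ : ∀ i, 0 ≤ Q i)
    (h : (∀ i, P i ≠ 0 → Q i ≠ 0) ∨ 0 < a) (i : ι) :
    lift P i * lift Q i ^ a = ENNReal.ofReal (P i * Q i ^ a) := by
  rw [ENNReal.ofReal_mul (hP i), lift, lift]
  rcases (hQ i).eq_or_lt with h0 | hpos
  · rcases h with h | h
    · have : P i = 0 := by
        by_contra hne
        exact h i hne h0.symm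
      simp [this]
    · rw [ENNReal.ofReal_rpow_of_nonneg (hQ i) h.le]
  · rw [ENNReal.ofReal_rpow_of_pos hpos]

theorem sum_lift_mul_rpow {P Q : ι → ℝ} {a : ℝ} (hP : ∀ i, 0 ≤ P i) (hQ : ∀ i, 0 ≤ Q i)
    (h : (∀ i, P i ≠ 0 → Q i ≠ 0) ∨ 0 < a) :
    ∑ i, lift P i * lift Q i ^ a = ENNReal.ofReal (∑ i, P i * Q i ^ a) := by
  rw [ENNReal.ofReal_sum_of_nonneg fun i _ => mul_nonneg (hP i) (Real.rpow_nonneg (hQ i) a)]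
  exact Finset.sum_congr rfl fun i _ => lift_mul_rpow hP hQ h i

theorem log_sum_lift_rpow {P : ι → ℝ} {a : ℝ} (ha : 0 < a) (hP : P ∈ stdSimplex ℝ ι) :
    ENNReal.log (∑ i, lift P i ^ a) = (Real.log (∑ i, P i ^ a) : ℝ) := by
  rw [← ENNReal.log_ofReal_of_pos (sum_rpow_pos hP a),
    ENNReal.ofReal_sum_of_nonneg fun i _ => Real.rpow_nonneg (hP.1 i) a]
  congr 1
  exact Finset.sum_congr rfl fun i _ => ENNReal.ofReal_rpow_of_nonneg (hP.1 i) ha.le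

theorem relAlphaEntropy_lift {α : ℝ} (hα : 0 < α) (hα1 : α ≠ 1) {P Q : ι → ℝ}
    (hP : P ∈ stdSimplex ℝ ι) (hQ : Q ∈ stdSimplex ℝ ι)
    (h : (∀ i, P i ≠ 0 → Q i ≠ 0) ∨ 1 < α) (hpos : 0 < ∑ i, P i * Q i ^ (α - 1)) :
    relAlphaEntropy α (lift P) (lift Q) = ((α / (1 - α) * Real.log (∑ i, P i * Q i ^ (α - 1))
      + Real.log (∑ i, Q i ^ α) - entropy α P : ℝ) : EReal) := by
  rw [relAlphaEntropy, if_neg hα1, sum_lift_mul_rpow hP.1 hQ.1 (h.imp_right sub_pos.2),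
    log_sum_lift_rpow hα hP, log_sum_lift_rpow hα hQ, ENNReal.log_ofReal_of_pos hpos,
    entropy_of_ne hα1]
  push_cast
  rfl

theorem relAlphaEntropy_eq_top_of_one_lt {α : ℝ} (hα1 : 1 < α) {P Q : ι → ℝ}
    (hP : P ∈ stdSimplex ℝ ι) (hQ : Q ∈ stdSimplex ℝ ι)
    (h0 : ∑ i, P i * Q i ^ (α - 1) = 0) :
    relAlphaEntropy α (lift P) (lift Q) = ⊤ := by
  have hα : 0 < α := by linarith
  rw [relAlphaEntropy, if_neg hα1.ne', sum_lift_mul_rpow hP.1 hQ.1 (Or.inr (sub_pos.2 hα1)),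
    log_sum_lift_rpow hα hP, log_sum_lift_rpow hα hQ, h0, ENNReal.ofReal_zero, ENNReal.log_zero,
    EReal.coe_mul_bot_of_neg (div_neg_of_pos_of_neg hα (by linarith)), ← EReal.coe_mul]
  rfl

theorem relAlphaEntropy_eq_top_of_lt_one {α : ℝ} (hα : 0 < α) (hα1 : α < 1) {P Q : ι → ℝ}
    (hP : P ∈ stdSimplex ℝ ι) (hQ : Q ∈ stdSimplex ℝ ι)
    (h : ¬ ∀ i, P i ≠ 0 → Q i ≠ 0) :
    relAlphaEntropy α (lift P) (lift Q) = ⊤ := by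
  push Not at h
  obtain ⟨i, hPi, hQi⟩ := h
  have htop : ∑ i, lift P i * lift Q i ^ (α - 1) = ⊤ := by
    refine ENNReal.sum_eq_top.2 ⟨i, Finset.mem_univ i, ?_⟩
    have : lift P i ≠ 0 := by
      simpa [lift] using lt_of_le_of_ne (hP.1 i) hPi.symm
    rw [show lift Q i = 0 by simp [lift, hQi], ENNReal.zero_rpow_of_neg (by linarith),
      ENNReal.mul_top this]
  rw [relAlphaEntropy, if_neg hα1.ne, htop,
    log_sum_lift_rpow hα hP, log_sum_lift_rpow hα hQ, ENNReal.log_top,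
    EReal.coe_mul_top_of_pos (div_pos hα (by linarith)), ← EReal.coe_mul]
  rfl

theorem sum_mul_escort_rpow_eq {α : ℝ} {P T : ι → ℝ} (hT : T ∈ stdSimplex ℝ ι) :
    ∑ i, P i * escort (1 / α) T i ^ (α - 1) =
      (∑ i, P i * T i ^ ((α - 1) / α)) / (∑ i, T i ^ (1 / α)) ^ (α - 1) := by
  rw [Finset.sum_div]
  refine Finset.sum_congr rfl fun i _ => ?_
  rw [escort, Real.div_rpow (Real.rpow_nonneg (hT.1 i) _) (sum_rpow_pos hT _).le,
    ← Real.rpow_mul (hT.1 i), mul_div_assoc, one_div_mul_eq_div]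

/-- With `C = ∑ T ^ (1 / α)`, the moment term contributes `α log C` and the term `log ∑ Q ^ α`
contributes `-α log C`, so the normalisation disappears. -/
theorem relAlphaEntropy_escort {α : ℝ} (hα : 0 < α) (hα1 : α ≠ 1) {P T : ι → ℝ}
    (hP : P ∈ stdSimplex ℝ ι) (hT : T ∈ stdSimplex ℝ ι)
    (h : (∀ i, P i ≠ 0 → T i ≠ 0) ∨ 1 < α) (hpos : 0 < ∑ i, P i * T i ^ ((α - 1) / α)) :
    relAlphaEntropy α (lift P) (lift (escort (1 / α) T)) =
      ((α / (1 - α) * Real.log (∑ i, P i * T i ^ ((α - 1) / α)) - entropy α P : ℝ) : EReal) := by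
  have hC := sum_rpow_pos hT (1 / α)
  have e := sum_mul_escort_rpow_eq (α := α) (P := P) hT
  have hpos' : 0 < ∑ i, P i * escort (1 / α) T i ^ (α - 1) := by
    rw [e]; exact div_pos hpos (Real.rpow_pos_of_pos hC _)
  rw [relAlphaEntropy_lift hα hα1 hP (escort_mem hT) (h.imp_left fun h i hi =>
    (escort_ne_zero_iff (one_div_ne_zero hα.ne') hT i).2 (h i hi)) hpos', e]
  have e2 : ∑ i, escort (1 / α) T i ^ α = ((∑ i, T i ^ (1 / α)) ^ α)⁻¹ := by
    have : ∀ i, escort (1 / α) T i ^ α = T i * ((∑ i, T i ^ (1 / α)) ^ α)⁻¹ := fun i => by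
      rw [escort, Real.div_rpow (Real.rpow_nonneg (hT.1 i) _) hC.le, ← Real.rpow_mul (hT.1 i),
        one_div_mul_cancel hα.ne', Real.rpow_one, div_eq_mul_inv]
    simp_rw [this]
    rw [← Finset.sum_mul, hT.2, one_mul]
  rw [e2, Real.log_inv, Real.log_rpow hC, Real.log_div hpos.ne' (Real.rpow_pos_of_pos hC _).ne',
    Real.log_rpow hC]
  have : 1 - α ≠ 0 := sub_ne_zero.2 hα1.symm
  congr 1
  field_simp
  ring

theorem sum_mul_rpow_nonneg {P T : ι → ℝ} (hP : ∀ i, 0 ≤ P i) (hT : ∀ i, 0 ≤ T i) (s : ℝ) :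
    0 ≤ ∑ i, P i * T i ^ s :=
  Finset.sum_nonneg fun i _ => mul_nonneg (hP i) (Real.rpow_nonneg (hT i) s)

theorem sum_mul_rpow_pos {P T : ι → ℝ} (hP : P ∈ stdSimplex ℝ ι) (hT : ∀ i, 0 ≤ T i)
    (h : ∀ i, P i ≠ 0 → T i ≠ 0) (s : ℝ) : 0 < ∑ i, P i * T i ^ s := by
  obtain ⟨i, hi⟩ := exists_pos_of_mem_stdSimplex hP
  exact Finset.sum_pos' (fun i _ => mul_nonneg (hP.1 i) (Real.rpow_nonneg (hT i) s))
    ⟨i, Finset.mem_univ i, mul_pos hi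
      (Real.rpow_pos_of_pos (lt_of_le_of_ne (hT i) (h i hi.ne').symm) s)⟩

/-- The factor `α / (1 - α)` is `-1 / s` with `s > 0`, so a lower bound on the divergence is an
upper bound on the moment. Infinite divergence is moment zero and needs no separate hypothesis. -/
theorem le_relAlphaEntropy_escort_iff_of_one_lt {α : ℝ} (hα1 : 1 < α) {P T : ι → ℝ}
    (hP : P ∈ stdSimplex ℝ ι) (hT : T ∈ stdSimplex ℝ ι) (c : ℝ) :
    (c : EReal) ≤ relAlphaEntropy α (lift P) (lift (escort (1 / α) T)) ↔
      ∑ i, P i * T i ^ ((α - 1) / α) ≤ Real.exp (-((α - 1) / α * (c + entropy α P))) := by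
  have hα : 0 < α := by linarith
  rcases (sum_mul_rpow_nonneg hP.1 hT.1 ((α - 1) / α)).eq_or_lt with h0 | hpos
  · rw [relAlphaEntropy_eq_top_of_one_lt hα1 hP (escort_mem hT), ← h0]
    · simp [Real.exp_nonneg]
    · rw [sum_mul_escort_rpow_eq hT, ← h0, zero_div]
  · rw [relAlphaEntropy_escort hα hα1.ne' hP hT (Or.inr hα1) hpos, EReal.coe_le_coe_iff,
      ← Real.log_le_iff_le_exp hpos]
    have hs : 0 < (α - 1) / α := div_pos (by linarith) hα
    have e : α / (1 - α) = -((α - 1) / α)⁻¹ := by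
      have : α - 1 ≠ 0 := by linarith
      have : 1 - α ≠ 0 := by linarith
      field_simp
      ring
    rw [e, le_sub_iff_add_le, neg_mul, le_neg, inv_mul_le_iff₀ hs, mul_neg]

/-- Now `s < 0` and the moment is bounded from below. Absolute continuity must be kept as a
hypothesis: without it the divergence is infinite, but the real-valued moment does not show this. -/
theorem le_relAlphaEntropy_escort_iff_of_lt_one {α : ℝ} (hα : 0 < α) (hα1 : α < 1) {P T : ι → ℝ}
    (hP : P ∈ stdSimplex ℝ ι) (hT : T ∈ stdSimplex ℝ ι) (c : ℝ) :
    (c : EReal) ≤ relAlphaEntropy α (lift P) (lift (escort (1 / α) T)) ↔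
      ((∀ i, P i ≠ 0 → T i ≠ 0) →
      Real.exp (-((α - 1) / α * (c + entropy α P))) ≤ ∑ i, P i * T i ^ ((α - 1) / α)) := by
  by_cases h : ∀ i, P i ≠ 0 → T i ≠ 0
  · have hpos := sum_mul_rpow_pos hP hT.1 h ((α - 1) / α)
    rw [relAlphaEntropy_escort hα hα1.ne hP hT (Or.inl h) hpos, EReal.coe_le_coe_iff,
      forall_prop_of_true h, ← Real.le_log_iff_exp_le hpos]
    have hs : 0 < (1 - α) / α := div_pos (by linarith) hα
    have e : α / (1 - α) = ((1 - α) / α)⁻¹ := by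
      rw [inv_div]
    have e2 : -((α - 1) / α * (c + entropy α P)) = (1 - α) / α * (c + entropy α P) := by ring
    rw [e, e2, le_sub_iff_add_le, le_inv_mul_iff₀ hs]
  · rw [relAlphaEntropy_eq_top_of_lt_one hα hα1 hP (escort_mem hT)]
    · simp [h]
    · intro h'
      exact h fun i hi => (escort_ne_zero_iff (one_div_ne_zero hα.ne') hT i).1 (h' i hi)

theorem coe_sum_ereal (f : ι → ℝ) : ((∑ i, f i : ℝ) : EReal) = ∑ i, (f i : EReal) :=
  map_sum (⟨⟨Real.toEReal, EReal.coe_zero⟩, EReal.coe_add⟩ : ℝ →+ EReal) f Finset.univ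

theorem relEntropy_lift {P Q : ι → ℝ} (hP : P ∈ stdSimplex ℝ ι) (hQ : Q ∈ stdSimplex ℝ ι)
    (h : ∀ i, P i ≠ 0 → Q i ≠ 0) :
    relEntropy (lift P) (lift Q) =
      ((∑ i, P i * Real.log (P i) - ∑ i, P i * Real.log (Q i) : ℝ) : EReal) := by
  rw [relEntropy, ← Finset.sum_sub_distrib, coe_sum_ereal]
  refine Finset.sum_congr rfl fun i _ => ?_
  rcases (hP.1 i).eq_or_lt with h0 | hpos
  · simp [lift, ← h0]
  · have hq : 0 < Q i := lt_of_le_of_ne (hQ.1 i) (h i hpos.ne').symm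
    rw [lift, lift, ← ENNReal.ofReal_div_of_pos hq, ENNReal.log_ofReal_of_pos (div_pos hpos hq),
      EReal.coe_ennreal_ofReal, max_eq_left (hP.1 i), ← EReal.coe_mul,
      Real.log_div hpos.ne' hq.ne', mul_sub]

theorem relEntropy_eq_top {P Q : ι → ℝ} (hP : P ∈ stdSimplex ℝ ι)
    (h : ¬ ∀ i, P i ≠ 0 → Q i ≠ 0) : relEntropy (lift P) (lift Q) = ⊤ := by
  push Not at h
  obtain ⟨i, hPi, hQi⟩ := h
  have hpos : 0 < P i := lt_of_le_of_ne (hP.1 i) hPi.symm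
  have hi : (lift P i : EReal) * ENNReal.log (lift P i / lift Q i) = ⊤ := by
    have h1 : lift P i ≠ 0 := by simpa [lift] using hpos
    rw [show lift Q i = 0 by simp [lift, hQi], ENNReal.div_zero h1, ENNReal.log_top, lift,
      EReal.coe_ennreal_ofReal, max_eq_left hpos.le, EReal.coe_mul_top_of_pos hpos]
  -- In `EReal`, `⊤ + ⊥ = ⊥`, so an infinite term makes the sum infinite only once no term is `⊥`.
  have hne : ∀ j, (lift P j : EReal) * ENNReal.log (lift P j / lift Q j) ≠ ⊥ := fun j => by
    rcases (hP.1 j).eq_or_lt with h0 | hj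
    · simp [lift, ← h0]
    · have h2 : ⊥ < ENNReal.log (lift P j / lift Q j) := by
        rw [ENNReal.bot_lt_log_iff]
        exact ENNReal.div_pos (by simpa [lift] using hj) ENNReal.ofReal_ne_top
      rw [lift, EReal.coe_ennreal_ofReal, max_eq_left hj.le]
      rw [lift] at h2
      induction' h3 : ENNReal.log (ENNReal.ofReal (P j) / lift Q j) with r
      · rw [h3] at h2; exact absurd h2 (lt_irrefl _)
      · rw [← EReal.coe_mul]; exact EReal.coe_ne_bot _
      · rw [EReal.coe_mul_top_of_pos hj]; exact top_ne_bot
  classical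
  rw [relEntropy, ← Finset.add_sum_erase _ _ (Finset.mem_univ i), hi]
  refine EReal.top_add_of_ne_bot ?_
  refine Finset.sum_induction _ (fun x : EReal => x ≠ ⊥) (fun a b ha hb => ?_) EReal.zero_ne_bot
    fun j _ => hne j
  rw [ne_eq, EReal.add_eq_bot_iff]
  exact not_or.2 ⟨ha, hb⟩

/-- Identifies the Hölder constant, the `α`-norm of `P`, with an exponential of its Rényi entropy.
-/
theorem exp_neg_mul_entropy {α : ℝ} (hα : 0 < α) (hα1 : α ≠ 1) {P : ι → ℝ}
    (hP : P ∈ stdSimplex ℝ ι) :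
    Real.exp (-((α - 1) / α * entropy α P)) = (∑ i, P i ^ α) ^ (1 / α) := by
  rw [entropy_of_ne hα1, Real.rpow_def_of_pos (sum_rpow_pos hP α)]
  have : 1 - α ≠ 0 := sub_ne_zero.2 hα1.symm
  congr 1
  field_simp
  ring

/-- A finite divergence excludes both degenerate cases, a support violation for `α < 1` and a zero
moment for `α > 1`, so the logarithm can be inverted. -/
theorem sum_eq_of_relAlphaEntropy_escort_eq {α : ℝ} (hα : 0 < α) (hα1 : α ≠ 1) {P T : ι → ℝ}
    (hP : P ∈ stdSimplex ℝ ι) (hT : T ∈ stdSimplex ℝ ι) {c : ℝ}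
    (h : relAlphaEntropy α (lift P) (lift (escort (1 / α) T)) = c) :
    ((∀ i, P i ≠ 0 → T i ≠ 0) ∨ 1 < α) ∧
      ∑ i, P i * T i ^ ((α - 1) / α) = Real.exp (-((α - 1) / α * (c + entropy α P))) := by
  have had : (∀ i, P i ≠ 0 → T i ≠ 0) ∨ 1 < α := by
    by_contra! hne
    obtain ⟨hac, hle⟩ := hne
    rw [relAlphaEntropy_eq_top_of_lt_one hα (lt_of_le_of_ne hle hα1) hP (escort_mem hT)] at h
    · exact EReal.coe_ne_top _ h.symm
    · intro h'
      obtain ⟨i, hi, hi'⟩ := hac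
      exact (escort_ne_zero_iff (one_div_ne_zero hα.ne') hT i).1 (h' i hi) hi'
  have hpos : 0 < ∑ i, P i * T i ^ ((α - 1) / α) := by
    rcases had with hac | hlt
    · exact sum_mul_rpow_pos hP hT.1 hac _
    · refine (sum_mul_rpow_nonneg hP.1 hT.1 _).lt_of_ne fun h0 => ?_
      rw [relAlphaEntropy_eq_top_of_one_lt hlt hP (escort_mem hT)
        (by rw [sum_mul_escort_rpow_eq hT, ← h0, zero_div])] at h
      exact EReal.coe_ne_top _ h.symm
  refine ⟨had, ?_⟩
  rw [relAlphaEntropy_escort hα hα1 hP hT had hpos, EReal.coe_eq_coe_iff] at h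
  rw [← h, ← Real.exp_log hpos]
  have : 1 - α ≠ 0 := sub_ne_zero.2 hα1.symm
  congr 1
  rw [Real.exp_log hpos]
  field_simp
  ring

theorem one_sub_order {α : ℝ} (hα : 0 < α) : 1 - (α - 1) / α = 1 / α := by
  field_simp
  ring

/-- In the variable `T = escort α Q` this is Hölder's inequality. Its equality case gives `escort α
P = escort α Q`, and inverting the escort gives `P = Q`. At order one it is Gibbs' inequality. -/
theorem relAlphaEntropy_lift_nonneg {α : ℝ} (hα : 0 < α) {P Q : ι → ℝ}
    (hP : P ∈ stdSimplex ℝ ι) (hQ : Q ∈ stdSimplex ℝ ι) :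
    0 ≤ relAlphaEntropy α (lift P) (lift Q) ∧
      (relAlphaEntropy α (lift P) (lift Q) = 0 → P = Q) := by
  rcases eq_or_ne α 1 with rfl | hα1
  · rw [relAlphaEntropy, if_pos rfl]
    by_cases h : ∀ i, P i ≠ 0 → Q i ≠ 0
    · rw [relEntropy_lift hP hQ h]
      obtain ⟨h1, h2⟩ := gibbs hP hQ h
      refine ⟨EReal.coe_nonneg.2 (sub_nonneg.2 h1), fun h0 => h2 ?_⟩
      have := EReal.coe_eq_zero.1 h0
      linarith
    · rw [relEntropy_eq_top hP h]
      exact ⟨le_top, fun h => absurd h EReal.top_ne_zero⟩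
  have hT := escort_mem (a := α) hQ
  have hQT : escort (1 / α) (escort α Q) = Q := escort_escort (mul_one_div_cancel hα.ne') hQ
  have hs := one_sub_order hα
  have hexp := exp_neg_mul_entropy hα hα1 hP
  have hα2 : 1 / (1 / α) = α := one_div_one_div α
  have hfin : ∀ i, escort α P i ≠ 0 → P i ≠ 0 := fun i => (escort_ne_zero_iff hα.ne' hP i).1
  constructor
  · rw [← hQT, ← EReal.coe_zero]
    rcases lt_or_gt_of_ne hα1 with hlt | hgt
    · rw [le_relAlphaEntropy_escort_iff_of_lt_one hα hlt hP hT, zero_add, hexp]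
      intro hac
      have := le_sum_mul_rpow (div_neg_of_neg_of_pos (by linarith) hα : (α - 1) / α < 0) hP hT.1
        hT.2.le hac
      rwa [hs, hα2] at this
    · rw [le_relAlphaEntropy_escort_iff_of_one_lt hgt hP hT, zero_add, hexp]
      have := sum_mul_rpow_le (div_pos (by linarith) hα : 0 < (α - 1) / α)
        ((div_lt_one hα).2 (by linarith)) hP hT.1 hT.2.le
      rwa [hs, hα2] at this
  · intro h0
    rw [← hQT, ← EReal.coe_zero] at h0
    obtain ⟨had, he⟩ := sum_eq_of_relAlphaEntropy_escort_eq hα hα1 hP hT h0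
    rw [zero_add, hexp, sum_mul_rpow_eq_escort ((div_lt_one hα).2 (by linarith)) hP, hs, hα2,
      mul_eq_left₀ (Real.rpow_pos_of_pos (sum_rpow_pos hP α) _).ne', ← hs] at he
    have heq : escort α P = escort α Q := by
      rcases lt_or_gt_of_ne hα1 with hlt | hgt
      · exact eq_of_sum_rpow_mul_rpow_eq_one_of_neg (div_neg_of_neg_of_pos (by linarith) hα)
          (escort_mem hP) hT
          (fun i hi => (had.resolve_right hlt.not_gt) i (hfin i hi)) he
      · exact eq_of_sum_rpow_mul_rpow_eq_one (div_pos (by linarith) hα)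
          ((div_lt_one hα).2 (by linarith)) (escort_mem hP) hT he
    rw [← hQT, ← heq, escort_escort (mul_one_div_cancel hα.ne') hP]

end Divergences

/-! ### The minimum over products: attainment, continuity away from order one, vanishing, symmetry.
-/

section MinDiv

variable {ι κ : Type*} [Fintype ι] [Fintype κ]

/-- The minimum over product mass functions of the relative `α`-entropy from `P`. -/
noncomputable def minDiv (α : ℝ) (P : ι × κ → ℝ) : EReal :=
  ⨅ (QX : PMF ι) (QY : PMF κ), relAlphaEntropy α (lift P) (prodPmf QX QY)

theorem exists_pmf_eq_lift {q : ι → ℝ} (hq : q ∈ stdSimplex ℝ ι) :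
    ∃ Q : PMF ι, (Q : ι → ℝ≥0∞) = lift q :=
  ⟨PMF.ofFintype (lift q) (by
    simp only [lift]
    rw [← ENNReal.ofReal_sum_of_nonneg fun i _ => hq.1 i, hq.2, ENNReal.ofReal_one]), rfl⟩

theorem exists_lift_eq_of_sum_eq_one {Q : ι → ℝ≥0∞} (hQ : ∑ i, Q i = 1) :
    (fun i => (Q i).toReal) ∈ stdSimplex ℝ ι ∧ Q = lift fun i => (Q i).toReal := by
  have hne : ∀ i, Q i ≠ ⊤ := fun i h => by
    have := Finset.single_le_sum (f := Q) (fun _ _ => zero_le) (Finset.mem_univ i)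
    rw [hQ, h] at this
    simp at this
  refine ⟨⟨fun i => ENNReal.toReal_nonneg, ?_⟩,
    funext fun i => (ENNReal.ofReal_toReal (hne i)).symm⟩
  rw [← ENNReal.toReal_sum fun i _ => hne i, hQ, ENNReal.toReal_one]

theorem exists_eq_lift (Q : PMF ι) : ∃ q ∈ stdSimplex ℝ ι, (Q : ι → ℝ≥0∞) = lift q :=
  have h := exists_lift_eq_of_sum_eq_one (Q := Q)
    (by rw [← tsum_fintype (L := .unconditional _), Q.tsum_coe])
  ⟨_, h⟩

theorem le_minDiv_iff {α : ℝ} {P : ι × κ → ℝ} {c : EReal} :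
    c ≤ minDiv α P ↔ ∀ r ∈ stdSimplex ℝ ι, ∀ t ∈ stdSimplex ℝ κ,
      c ≤ relAlphaEntropy α (lift P) (lift fun z => r z.1 * t z.2) := by
  rw [minDiv, le_iInf₂_iff]
  constructor
  · intro h r hr t ht
    obtain ⟨R, hR⟩ := exists_pmf_eq_lift hr
    obtain ⟨T, hT⟩ := exists_pmf_eq_lift ht
    rw [← prodPmf_lift hr.1, ← hR, ← hT]
    exact h R T
  · intro h R T
    obtain ⟨r, hr, hR⟩ := exists_eq_lift R
    obtain ⟨t, ht, hT⟩ := exists_eq_lift T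
    rw [hR, hT, prodPmf_lift hr.1]
    exact h r hr t ht

theorem minDiv_le {r : ι → ℝ} {t : κ → ℝ} (hr : r ∈ stdSimplex ℝ ι) (ht : t ∈ stdSimplex ℝ κ)
    (α : ℝ) (P : ι × κ → ℝ) :
    minDiv α P ≤ relAlphaEntropy α (lift P) (lift fun z => r z.1 * t z.2) :=
  le_minDiv_iff.1 le_rfl r hr t ht

/-- Escorts of products are products of escorts, so the change of variables preserves the feasible
set. -/
theorem le_minDiv_iff_escort {α : ℝ} (hα : 0 < α) {P : ι × κ → ℝ} {c : EReal} :
    c ≤ minDiv α P ↔ ∀ r ∈ stdSimplex ℝ ι, ∀ t ∈ stdSimplex ℝ κ,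
      c ≤ relAlphaEntropy α (lift P) (lift (escort (1 / α) fun z => r z.1 * t z.2)) := by
  rw [le_minDiv_iff]
  constructor
  · intro h r hr t ht
    rw [escort_prod _ hr.1 ht.1]
    exact h _ (escort_mem hr) _ (escort_mem ht)
  · intro h r hr t ht
    have := h _ (escort_mem (a := α) hr) _ (escort_mem (a := α) ht)
    rwa [escort_prod _ (escort_mem hr).1 (escort_mem ht).1,
      escort_escort (mul_one_div_cancel hα.ne') hr,
      escort_escort (mul_one_div_cancel hα.ne') ht] at this

theorem le_minDiv_iff_of_one_lt {α : ℝ} (hα1 : 1 < α) {P : ι × κ → ℝ}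
    (hP : P ∈ stdSimplex ℝ (ι × κ)) (c : ℝ) :
    (c : EReal) ≤ minDiv α P ↔ ∀ r ∈ stdSimplex ℝ ι, ∀ t ∈ stdSimplex ℝ κ,
      ∑ z, P z * (r z.1 * t z.2) ^ ((α - 1) / α) ≤
        Real.exp (-((α - 1) / α * (c + entropy α P))) := by
  rw [le_minDiv_iff_escort (by linarith)]
  exact forall₄_congr fun r hr t ht =>
    le_relAlphaEntropy_escort_iff_of_one_lt hα1 hP (prod_mem hr ht) c

theorem le_minDiv_iff_of_lt_one {α : ℝ} (hα : 0 < α) (hα1 : α < 1) {P : ι × κ → ℝ}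
    (hP : P ∈ stdSimplex ℝ (ι × κ)) (c : ℝ) :
    (c : EReal) ≤ minDiv α P ↔ ∀ r ∈ stdSimplex ℝ ι, ∀ t ∈ stdSimplex ℝ κ,
      (∀ z, P z ≠ 0 → r z.1 * t z.2 ≠ 0) → Real.exp (-((α - 1) / α * (c + entropy α P))) ≤
        ∑ z, P z * (r z.1 * t z.2) ^ ((α - 1) / α) := by
  rw [le_minDiv_iff_escort hα]
  exact forall₄_congr fun r hr t ht =>
    le_relAlphaEntropy_escort_iff_of_lt_one hα hα1 hP (prod_mem hr ht) c

theorem minDiv_le_escort {α : ℝ} (hα : 0 < α) (hα1 : α ≠ 1) {P : ι × κ → ℝ}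
    (hP : P ∈ stdSimplex ℝ (ι × κ)) {r : ι → ℝ} {t : κ → ℝ} (hr : r ∈ stdSimplex ℝ ι)
    (ht : t ∈ stdSimplex ℝ κ) (h : (∀ z, P z ≠ 0 → r z.1 * t z.2 ≠ 0) ∨ 1 < α)
    (hpos : 0 < ∑ z, P z * (r z.1 * t z.2) ^ ((α - 1) / α)) :
    minDiv α P ≤ ((α / (1 - α) * Real.log (∑ z, P z * (r z.1 * t z.2) ^ ((α - 1) / α))
      - entropy α P : ℝ) : EReal) := by
  rw [← relAlphaEntropy_escort hα hα1 hP (prod_mem hr ht) h hpos, escort_prod _ hr.1 ht.1]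
  exact minDiv_le (escort_mem hr) (escort_mem ht) α P

theorem minDiv_nonneg {α : ℝ} (hα : 0 < α) {P : ι × κ → ℝ} (hP : P ∈ stdSimplex ℝ (ι × κ)) :
    0 ≤ minDiv α P :=
  le_minDiv_iff.2 fun _ hr _ ht => (relAlphaEntropy_lift_nonneg hα hP (prod_mem hr ht)).1

/-- For a negative exponent the power is the inverse of a positive one, and inversion is continuous
on `[0, ∞]`. Exponent zero is excluded because of the jump at `0 ^ 0`. -/
theorem continuous_lift_rpow {Z : Type*} [TopologicalSpace Z] {x a : Z → ℝ}
    (hx : Continuous x) (hx0 : ∀ z, 0 ≤ x z) (ha : Continuous a) (ha0 : ∀ z, a z ≠ 0) :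
    Continuous fun z => ENNReal.ofReal (x z) ^ a z := by
  rw [continuous_iff_continuousAt]
  intro z
  rcases lt_or_gt_of_ne (ha0 z) with h | h
  · have hev : ∀ᶠ w in 𝓝 z, (ENNReal.ofReal (x w ^ (-a w)))⁻¹ = ENNReal.ofReal (x w) ^ a w := by
      filter_upwards [ha.continuousAt.eventually (gt_mem_nhds h)] with w hw
      rw [← ENNReal.ofReal_rpow_of_nonneg (hx0 w) (by linarith), ENNReal.rpow_neg, inv_inv]
    refine ContinuousAt.congr ?_ hev
    refine (ENNReal.continuous_ofReal.continuousAt.comp ?_).inv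
    exact hx.continuousAt.rpow ha.neg.continuousAt (Or.inr (by linarith))
  · have hev : ∀ᶠ w in 𝓝 z, ENNReal.ofReal (x w ^ a w) = ENNReal.ofReal (x w) ^ a w := by
      filter_upwards [ha.continuousAt.eventually (lt_mem_nhds h)] with w hw
      rw [ENNReal.ofReal_rpow_of_nonneg (hx0 w) hw.le]
    refine ContinuousAt.congr ?_ hev
    exact ENNReal.continuous_ofReal.continuousAt.comp
      (hx.continuousAt.rpow ha.continuousAt (Or.inr h))

theorem continuous_log_sum_rpow {Z : Type*} [TopologicalSpace Z] {Q : Z → ι → ℝ} {a : Z → ℝ}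
    (hQ : Continuous Q) (hQs : ∀ z, Q z ∈ stdSimplex ℝ ι) (ha : Continuous a)
    (ha0 : ∀ z, 0 < a z) : Continuous fun z => Real.log (∑ i, Q z i ^ a z) :=
  (continuous_finsetSum _ fun i _ => ((continuous_apply i).comp hQ).rpow ha
    fun z => Or.inr (ha0 z)).log fun z => (sum_rpow_pos (hQs z) _).ne'

theorem continuous_relAlphaEntropy {Z : Type*} [TopologicalSpace Z] {P : ι → ℝ}
    (hP : P ∈ stdSimplex ℝ ι) {Q : Z → ι → ℝ} {a : Z → ℝ} (hQ : Continuous Q)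
    (hQs : ∀ z, Q z ∈ stdSimplex ℝ ι) (ha : Continuous a) (ha0 : ∀ z, 0 < a z)
    (ha1 : ∀ z, a z ≠ 1) : Continuous fun z => relAlphaEntropy (a z) (lift P) (lift (Q z)) := by
  have ha1' : ∀ z, 1 - a z ≠ 0 := fun z => sub_ne_zero.2 (ha1 z).symm
  -- Only the first product can be infinite. Grouping the rest into one real number keeps `EReal`
  -- multiplication and addition at points where they are continuous.
  have e : (fun z => relAlphaEntropy (a z) (lift P) (lift (Q z))) = fun z =>
      ((a z / (1 - a z) : ℝ) : EReal) *
        ENNReal.log (∑ i, lift P i * lift (Q z) i ^ (a z - 1)) +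
      ((Real.log (∑ i, Q z i ^ a z) - 1 / (1 - a z) * Real.log (∑ i, P i ^ a z) : ℝ) : EReal) := by
    funext z
    rw [relAlphaEntropy, if_neg (ha1 z), log_sum_lift_rpow (ha0 z) hP,
      log_sum_lift_rpow (ha0 z) (hQs z), EReal.coe_sub, EReal.coe_mul, sub_eq_add_neg,
      sub_eq_add_neg, add_assoc]
    rfl
  rw [e]
  have hc1 : Continuous fun z => ENNReal.log (∑ i, lift P i * lift (Q z) i ^ (a z - 1)) := by
    refine ENNReal.continuous_log.comp (continuous_finsetSum _ fun i _ => ?_)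
    exact (ENNReal.continuous_const_mul ENNReal.ofReal_ne_top).comp
      (continuous_lift_rpow ((continuous_apply i).comp hQ) (fun z => (hQs z).1 i)
        (ha.sub continuous_const) fun z => sub_ne_zero.2 (ha1 z))
  have hc2 : Continuous fun z => Real.log (∑ i, Q z i ^ a z) -
      1 / (1 - a z) * Real.log (∑ i, P i ^ a z) :=
    (continuous_log_sum_rpow hQ hQs ha ha0).sub
      ((continuous_const.div (continuous_const.sub ha) ha1').mul
        (continuous_log_sum_rpow continuous_const (fun _ => hP) ha ha0))
  have hc3 : Continuous fun z => a z / (1 - a z) := ha.div (continuous_const.sub ha) ha1'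
  rw [continuous_iff_continuousAt]
  intro z
  refine ContinuousAt.comp₂ (f := fun p : EReal × EReal => p.1 + p.2)
    (EReal.continuousAt_add (Or.inr (EReal.coe_ne_bot _)) (Or.inr (EReal.coe_ne_top _)))
    (ContinuousAt.comp₂ (f := fun p : EReal × EReal => p.1 * p.2)
      (EReal.continuousAt_mul ?_ ?_ ?_ ?_)
      (continuous_coe_real_ereal.comp hc3).continuousAt hc1.continuousAt)
    (continuous_coe_real_ereal.comp hc2).continuousAt
  · exact Or.inl (EReal.coe_ne_zero.2 (div_ne_zero (ha0 z).ne' (ha1' z)))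
  · exact Or.inl (EReal.coe_ne_zero.2 (div_ne_zero (ha0 z).ne' (ha1' z)))
  · exact Or.inl (EReal.coe_ne_bot _)
  · exact Or.inl (EReal.coe_ne_top _)

/-- The objective of `minDiv` as a function on the product of simplices. -/
noncomputable def objective (P : ι × κ → ℝ) (α : ℝ)
    (w : stdSimplex ℝ ι × stdSimplex ℝ κ) : EReal :=
  relAlphaEntropy α (lift P) (lift fun z => w.1.1 z.1 * w.2.1 z.2)

theorem minDiv_eq_sInf (α : ℝ) (P : ι × κ → ℝ) :
    minDiv α P = sInf (objective P α '' Set.univ) := by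
  rw [Set.image_univ]
  refine le_antisymm (le_sInf ?_) ?_
  · rintro _ ⟨w, rfl⟩
    exact minDiv_le w.1.2 w.2.2 α P
  · exact le_minDiv_iff.2 fun r hr t ht => sInf_le ⟨(⟨r, hr⟩, ⟨t, ht⟩), rfl⟩

theorem continuous_objective {Z : Type*} [TopologicalSpace Z] {P : ι × κ → ℝ}
    (hP : P ∈ stdSimplex ℝ (ι × κ)) {a : Z → ℝ} (ha : Continuous a) (ha0 : ∀ z, 0 < a z)
    (ha1 : ∀ z, a z ≠ 1) :
    Continuous fun y : Z × (stdSimplex ℝ ι × stdSimplex ℝ κ) => objective P (a y.1) y.2 :=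
  continuous_relAlphaEntropy hP
    (Q := fun (y : Z × (stdSimplex ℝ ι × stdSimplex ℝ κ)) z => y.2.1.1 z.1 * y.2.2.1 z.2)
    (continuous_pi fun z => ((continuous_apply z.1).comp (continuous_subtype_val.comp
      (continuous_fst.comp continuous_snd))).mul ((continuous_apply z.2).comp
        (continuous_subtype_val.comp (continuous_snd.comp continuous_snd))))
    (fun y => prod_mem y.2.1.2 y.2.2.2) (ha.comp continuous_fst) (fun y => ha0 y.1)
    (fun y => ha1 y.1)

/-- The infimum over a compact set of a jointly continuous objective is continuous in the parameter.
Order one is excluded because the coefficients have a pole there. -/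
theorem continuousAt_minDiv {P : ι × κ → ℝ} (hP : P ∈ stdSimplex ℝ (ι × κ)) {α : ℝ}
    (hα : 0 < α) (hα1 : α ≠ 1) : ContinuousAt (fun a => minDiv a P) α := by
  have hopen : IsOpen {a : ℝ | 0 < a ∧ a ≠ 1} := isOpen_Ioi.inter isOpen_ne
  have hc : Continuous fun a : {a : ℝ | 0 < a ∧ a ≠ 1} =>
      sInf (objective P a.1 '' Set.univ) :=
    isCompact_univ.continuous_sInf (continuous_objective hP continuous_subtype_val
      (fun a => a.2.1) fun a => a.2.2)
  simp_rw [← minDiv_eq_sInf] at hc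
  exact (continuousOn_iff_continuous_domRestrict.2 hc).continuousAt (hopen.mem_nhds ⟨hα, hα1⟩)

theorem marginals_mem {P : ι × κ → ℝ} (hP : P ∈ stdSimplex ℝ (ι × κ)) :
    (fun i => ∑ j, P (i, j)) ∈ stdSimplex ℝ ι ∧ (fun j => ∑ i, P (i, j)) ∈ stdSimplex ℝ κ :=
  ⟨⟨fun i => Finset.sum_nonneg fun _ _ => hP.1 _, by rw [← Fintype.sum_prod_type, hP.2]⟩,
    ⟨fun i => Finset.sum_nonneg fun _ _ => hP.1 _, by rw [← Fintype.sum_prod_type_right, hP.2]⟩⟩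

theorem sum_mul_fst (P : ι × κ → ℝ) (f : ι → ℝ) :
    ∑ z, P z * f z.1 = ∑ i, (∑ j, P (i, j)) * f i := by
  rw [Fintype.sum_prod_type]
  simp_rw [Finset.sum_mul]

theorem sum_mul_snd (P : ι × κ → ℝ) (f : κ → ℝ) :
    ∑ z, P z * f z.2 = ∑ j, (∑ i, P (i, j)) * f j := by
  rw [Fintype.sum_prod_type_right]
  simp_rw [Finset.sum_mul]

theorem le_marginals {P : ι × κ → ℝ} (hP : ∀ z, 0 ≤ P z) (z : ι × κ) :
    P z ≤ ∑ j, P (z.1, j) ∧ P z ≤ ∑ i, P (i, z.2) :=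
  ⟨Finset.single_le_sum (f := fun j => P (z.1, j)) (fun _ _ => hP _) (Finset.mem_univ z.2),
    Finset.single_le_sum (f := fun i => P (i, z.2)) (fun _ _ => hP _) (Finset.mem_univ z.1)⟩

theorem marginals_ne_zero {P : ι × κ → ℝ} (hP : ∀ z, 0 ≤ P z) (z : ι × κ) (h : P z ≠ 0) :
    (∑ j, P (z.1, j)) * (∑ i, P (i, z.2)) ≠ 0 := by
  have hpos := lt_of_le_of_ne (hP z) h.symm
  exact (mul_pos (hpos.trans_le (le_marginals hP z).1) (hpos.trans_le (le_marginals hP z).2)).ne'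

omit [Fintype ι] in
/-- Absolute continuity with respect to a product passes to the first marginal. -/
theorem fst_ne_zero {P : ι × κ → ℝ} {r : ι → ℝ} {t : κ → ℝ}
    (h : ∀ z, P z ≠ 0 → r z.1 * t z.2 ≠ 0) (i : ι) (hi : ∑ j, P (i, j) ≠ 0) : r i ≠ 0 := by
  obtain ⟨j, -, hj⟩ := Finset.exists_ne_zero_of_sum_ne_zero hi
  exact left_ne_zero_of_mul (h _ hj)

omit [Fintype κ] in
theorem snd_ne_zero {P : ι × κ → ℝ} {r : ι → ℝ} {t : κ → ℝ}
    (h : ∀ z, P z ≠ 0 → r z.1 * t z.2 ≠ 0) (j : κ) (hj : ∑ i, P (i, j) ≠ 0) : t j ≠ 0 := by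
  obtain ⟨i, -, hi⟩ := Finset.exists_ne_zero_of_sum_ne_zero hj
  exact right_ne_zero_of_mul (h _ hi)

theorem sum_mul_log_prod {P : ι × κ → ℝ} {r : ι → ℝ} {t : κ → ℝ}
    (h : ∀ z, P z ≠ 0 → r z.1 * t z.2 ≠ 0) :
    ∑ z, P z * Real.log (r z.1 * t z.2) =
      ∑ i, (∑ j, P (i, j)) * Real.log (r i) + ∑ j, (∑ i, P (i, j)) * Real.log (t j) := by
  rw [← sum_mul_fst P fun i => Real.log (r i), ← sum_mul_snd P fun j => Real.log (t j),
    ← Finset.sum_add_distrib]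
  refine Finset.sum_congr rfl fun z _ => ?_
  by_cases hz : P z = 0
  · simp [hz]
  · rw [Real.log_mul (left_ne_zero_of_mul (h z hz)) (right_ne_zero_of_mul (h z hz)), mul_add]

theorem sum_mul_log_prod_le {P : ι × κ → ℝ} (hP : P ∈ stdSimplex ℝ (ι × κ)) {r : ι → ℝ}
    {t : κ → ℝ} (hr : r ∈ stdSimplex ℝ ι) (ht : t ∈ stdSimplex ℝ κ)
    (h : ∀ z, P z ≠ 0 → r z.1 * t z.2 ≠ 0) :
    ∑ z, P z * Real.log (r z.1 * t z.2) ≤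
      -(entropy 1 (fun i => ∑ j, P (i, j)) + entropy 1 fun j => ∑ i, P (i, j)) := by
  obtain ⟨h1, h2⟩ := marginals_mem hP
  have g1 := (gibbs h1 hr (fst_ne_zero h)).1
  have g2 := (gibbs h2 ht (snd_ne_zero h)).1
  rw [sum_mul_log_prod h, entropy_one, entropy_one]
  linarith

theorem relAlphaEntropy_marginals {P : ι × κ → ℝ} (hP : P ∈ stdSimplex ℝ (ι × κ)) :
    relAlphaEntropy 1 (lift P) (lift fun z => (∑ j, P (z.1, j)) * ∑ i, P (i, z.2)) =
      ((entropy 1 (fun i => ∑ j, P (i, j)) + entropy 1 (fun j => ∑ i, P (i, j)) - entropy 1 P : ℝ) :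
        EReal) := by
  obtain ⟨h1, h2⟩ := marginals_mem hP
  rw [relAlphaEntropy, if_pos rfl, relEntropy_lift hP (prod_mem h1 h2) (marginals_ne_zero hP.1),
    sum_mul_log_prod (r := fun i => ∑ j, P (i, j)) (t := fun j => ∑ i, P (i, j))
      (marginals_ne_zero hP.1), entropy_one, entropy_one, entropy_one]
  congr 1
  ring

/-- The logarithm splits the cross-entropy into one term for each factor, and Gibbs' inequality
optimises each separately at the corresponding marginal. -/
theorem minDiv_one {P : ι × κ → ℝ} (hP : P ∈ stdSimplex ℝ (ι × κ)) :
    minDiv 1 P = ((entropy 1 (fun i => ∑ j, P (i, j)) + entropy 1 (fun j => ∑ i, P (i, j)) -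
      entropy 1 P : ℝ) : EReal) := by
  obtain ⟨h1, h2⟩ := marginals_mem hP
  refine le_antisymm ?_ (le_minDiv_iff.2 fun r hr t ht => ?_)
  · rw [← relAlphaEntropy_marginals hP]
    exact minDiv_le h1 h2 1 P
  · rw [relAlphaEntropy, if_pos rfl]
    by_cases h : ∀ z, P z ≠ 0 → r z.1 * t z.2 ≠ 0
    · rw [relEntropy_lift hP (prod_mem hr ht) h, EReal.coe_le_coe_iff]
      have := sum_mul_log_prod_le hP hr ht h
      rw [entropy_one P]
      linarith
    · rw [relEntropy_eq_top hP h]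
      exact le_top

theorem nonempty_stdSimplex {p : ι → ℝ} (hp : p ∈ stdSimplex ℝ ι) : Nonempty (stdSimplex ℝ ι) :=
  ⟨⟨p, hp⟩⟩

/-- The minimum is attained. -/
theorem exists_relAlphaEntropy_eq_minDiv {α : ℝ} (hα : 0 < α) {P : ι × κ → ℝ}
    (hP : P ∈ stdSimplex ℝ (ι × κ)) :
    ∃ r ∈ stdSimplex ℝ ι, ∃ t ∈ stdSimplex ℝ κ,
      relAlphaEntropy α (lift P) (lift fun z => r z.1 * t z.2) = minDiv α P := by
  obtain ⟨h1, h2⟩ := marginals_mem hP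
  rcases eq_or_ne α 1 with rfl | hα1
  · exact ⟨_, h1, _, h2, by rw [relAlphaEntropy_marginals hP, minDiv_one hP]⟩
  · have := nonempty_stdSimplex h1
    have := nonempty_stdSimplex h2
    have hj := continuous_objective hP (a := fun _ : Unit => α) continuous_const (fun _ => hα)
      fun _ => hα1
    have hc : Continuous (objective P α) := by
      have := hj.comp (Continuous.prodMk_right ())
      exact this
    obtain ⟨w, -, hw⟩ := isCompact_univ.exists_sInf_image_eq Set.univ_nonempty hc.continuousOn
    exact ⟨w.1.1, w.1.2, w.2.1, w.2.2, by rw [minDiv_eq_sInf, hw]; rfl⟩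

theorem minDiv_eq_zero_iff {α : ℝ} (hα : 0 < α) {P : ι × κ → ℝ}
    (hP : P ∈ stdSimplex ℝ (ι × κ)) :
    minDiv α P = 0 ↔ ∀ z, P z = (∑ j, P (z.1, j)) * ∑ i, P (i, z.2) := by
  constructor
  · intro h0
    obtain ⟨r, hr, t, ht, h⟩ := exists_relAlphaEntropy_eq_minDiv hα hP
    -- Zero divergence at a minimiser makes `P` itself a product, whose factors must then be its
    -- marginals.
    have hPr := (relAlphaEntropy_lift_nonneg hα hP (prod_mem hr ht)).2 (h.trans h0)
    intro z
    have e1 : ∑ j, P (z.1, j) = r z.1 := by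
      simp only [hPr]
      rw [← Finset.mul_sum, ht.2, mul_one]
    have e2 : ∑ i, P (i, z.2) = t z.2 := by
      simp only [hPr]
      rw [← Finset.sum_mul, hr.2, one_mul]
    rw [e1, e2, congrFun hPr z]
  · intro h
    obtain ⟨h1, h2⟩ := marginals_mem hP
    refine le_antisymm ?_ (minDiv_nonneg hα hP)
    refine (minDiv_le h1 h2 α P).trans ?_
    rw [← funext h]
    rcases eq_or_ne α 1 with rfl | hα1
    · rw [relAlphaEntropy, if_pos rfl, relEntropy_lift hP hP fun _ h => h, sub_self]
      rfl
    · have e : ∀ z, P z * P z ^ (α - 1) = P z ^ α := fun z => by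
        rcases (hP.1 z).eq_or_lt with h0 | h0
        · simp [← h0, Real.zero_rpow hα.ne']
        · rw [Real.rpow_sub_one h0.ne']; field_simp
      rw [relAlphaEntropy_lift hα hα1 hP hP (Or.inl fun _ h => h)
        (sum_mul_rpow_pos hP hP.1 (fun _ h => h) _), entropy_of_ne hα1]
      simp_rw [e]
      have : 1 - α ≠ 0 := sub_ne_zero.2 hα1.symm
      rw [← EReal.coe_zero, EReal.coe_le_coe_iff]
      apply le_of_eq
      field_simp
      ring

theorem minDiv_swap_le (α : ℝ) (P : ι × κ → ℝ) :
    minDiv α P ≤ minDiv α (fun z => P z.swap) := by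
  refine le_minDiv_iff.2 fun r hr t ht => (minDiv_le ht hr α P).trans_eq ?_
  simp only [relAlphaEntropy, relEntropy]
  have h1 : ∀ f : ι × κ → EReal, ∑ x, f x = ∑ x : κ × ι, f x.swap := fun f =>
    (Fintype.sum_equiv (Equiv.prodComm κ ι) _ _ fun _ => rfl).symm
  have h2 : ∀ f : ι × κ → ℝ≥0∞, ∑ x, f x = ∑ x : κ × ι, f x.swap := fun f =>
    (Fintype.sum_equiv (Equiv.prodComm κ ι) _ _ fun _ => rfl).symm
  simp only [h1, h2, lift, Prod.fst_swap, Prod.snd_swap, mul_comm (t _)]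

theorem minDiv_swap (α : ℝ) (P : ι × κ → ℝ) :
    minDiv α (fun z => P z.swap) = minDiv α P :=
  le_antisymm (minDiv_swap_le α fun z => P z.swap) (minDiv_swap_le α P)

end MinDiv

/-! ### Entropy form of the moment bounds, the cardinality bound and finiteness. -/

section EntropyBounds

variable {ι κ : Type*} [Fintype ι] [Fintype κ]

theorem div_one_sub_mul_order {α : ℝ} (hα : 0 < α) (hα1 : α ≠ 1) (x : ℝ) :
    α / (1 - α) * -((α - 1) / α * x) = x := by
  have : 1 - α ≠ 0 := sub_ne_zero.2 hα1.symm
  field_simp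
  ring

theorem sum_mul_rpow_le_exp {α : ℝ} (hα1 : 1 < α) {p T : ι → ℝ} (hp : p ∈ stdSimplex ℝ ι)
    (hT : ∀ i, 0 ≤ T i) (hT1 : ∑ i, T i ≤ 1) :
    ∑ i, p i * T i ^ ((α - 1) / α) ≤ Real.exp (-((α - 1) / α * entropy α p)) := by
  have hα : 0 < α := by linarith
  have := sum_mul_rpow_le (div_pos (by linarith) hα : 0 < (α - 1) / α)
    ((div_lt_one hα).2 (by linarith)) hp hT hT1
  rwa [one_sub_order hα, one_div_one_div, ← exp_neg_mul_entropy hα hα1.ne' hp] at this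

theorem exp_le_sum_mul_rpow {α : ℝ} (hα : 0 < α) (hα1 : α < 1) {p T : ι → ℝ}
    (hp : p ∈ stdSimplex ℝ ι) (hT : ∀ i, 0 ≤ T i) (hT1 : ∑ i, T i ≤ 1)
    (h : ∀ i, p i ≠ 0 → T i ≠ 0) :
    Real.exp (-((α - 1) / α * entropy α p)) ≤ ∑ i, p i * T i ^ ((α - 1) / α) := by
  have := le_sum_mul_rpow (div_neg_of_neg_of_pos (by linarith) hα : (α - 1) / α < 0) hp hT hT1 h
  rwa [one_sub_order hα, one_div_one_div, ← exp_neg_mul_entropy hα hα1.ne hp] at this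

theorem sum_mul_escort_eq_exp {α : ℝ} (hα : 0 < α) (hα1 : α ≠ 1) {p : ι → ℝ}
    (hp : p ∈ stdSimplex ℝ ι) :
    ∑ i, p i * escort α p i ^ ((α - 1) / α) = Real.exp (-((α - 1) / α * entropy α p)) := by
  have := sum_mul_escort_rpow ((div_lt_one hα).2 (by linarith) : (α - 1) / α < 1) hp
  rwa [one_sub_order hα, one_div_one_div, ← exp_neg_mul_entropy hα hα1 hp] at this

theorem rpow_eq_mul_rpow_sub_one {α x : ℝ} (hα : 0 < α) (hx : 0 ≤ x) :
    x ^ α = x * x ^ (α - 1) := by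
  rcases hx.eq_or_lt with h0 | h0
  · simp [← h0, Real.zero_rpow hα.ne']
  · rw [Real.rpow_sub_one h0.ne']; field_simp

/-- Rényi entropy does not increase when passing to the second marginal. -/
theorem entropy_snd_le {α : ℝ} (hα : 0 < α) (hα1 : α ≠ 1) {P : ι × κ → ℝ}
    (hP : P ∈ stdSimplex ℝ (ι × κ)) :
    entropy α (fun j => ∑ i, P (i, j)) ≤ entropy α P := by
  obtain ⟨-, h2⟩ := marginals_mem hP
  have hA := sum_rpow_pos h2 α
  have hB := sum_rpow_pos hP α
  -- Written as averages under `P`, the two power sums compare pointwise through `P z ≤ ∑ i, P (i,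
  -- z.2)`; the direction depends on the sign of `α - 1`.
  have eA : ∑ j, (∑ i, P (i, j)) ^ α = ∑ z, P z * (∑ i, P (i, z.2)) ^ (α - 1) := by
    rw [sum_mul_snd P fun j => (∑ i, P (i, j)) ^ (α - 1)]
    exact Finset.sum_congr rfl fun j _ => rpow_eq_mul_rpow_sub_one hα (h2.1 j)
  have eB : ∑ z, P z ^ α = ∑ z, P z * P z ^ (α - 1) :=
    Finset.sum_congr rfl fun z _ => rpow_eq_mul_rpow_sub_one hα (hP.1 z)
  rw [entropy_of_ne hα1, entropy_of_ne hα1]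
  rcases lt_or_gt_of_ne hα1 with hlt | hgt
  · refine mul_le_mul_of_nonneg_left (Real.log_le_log hA ?_) (one_div_pos.2 (by linarith)).le
    rw [eA, eB]
    refine Finset.sum_le_sum fun z _ => ?_
    rcases (hP.1 z).eq_or_lt with h0 | h0
    · simp [← h0]
    · exact mul_le_mul_of_nonneg_left (Real.rpow_le_rpow_of_nonpos h0 (le_marginals hP.1 z).2
        (by linarith)) h0.le
  · refine mul_le_mul_of_nonpos_left (Real.log_le_log hB ?_) (one_div_neg.2 (by linarith)).le
    rw [eA, eB]
    exact Finset.sum_le_sum fun z _ => mul_le_mul_of_nonneg_left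
      (Real.rpow_le_rpow (hP.1 z) (le_marginals hP.1 z).2 (by linarith)) (hP.1 z)

/-- Test `T` as the uniform mass function times the order-`α` escort of the second marginal. The
value is `log |ι|` plus the marginal entropy minus the joint entropy, and the marginal entropy is at
most the joint one. -/
theorem minDiv_le_log_card_of_ne {α : ℝ} (hα : 0 < α) (hα1 : α ≠ 1) {P : ι × κ → ℝ}
    (hP : P ∈ stdSimplex ℝ (ι × κ)) : minDiv α P ≤ (Real.log (Fintype.card ι) : ℝ) := by
  obtain ⟨h1, h2⟩ := marginals_mem hP
  have hne : Nonempty ι := (exists_pos_of_mem_stdSimplex h1).nonempty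
  have hn : (0 : ℝ) < Fintype.card ι := Nat.cast_pos.2 Fintype.card_pos
  have hu : (fun _ : ι => (Fintype.card ι : ℝ)⁻¹) ∈ stdSimplex ℝ ι :=
    ⟨fun _ => (inv_pos.2 hn).le, by simp [hn.ne']⟩
  have hE := escort_mem (a := α) h2
  have e : ∑ z, P z * ((Fintype.card ι : ℝ)⁻¹ *
      escort α (fun j => ∑ i, P (i, j)) z.2) ^ ((α - 1) / α) =
      Real.exp (-((α - 1) / α *
        (Real.log (Fintype.card ι) + entropy α fun j => ∑ i, P (i, j)))) := by
    rw [mul_add, neg_add, Real.exp_add, ← sum_mul_escort_eq_exp hα hα1 h2,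
      ← sum_mul_snd P fun j => escort α (fun j => ∑ i, P (i, j)) j ^ ((α - 1) / α),
      Finset.mul_sum]
    refine Finset.sum_congr rfl fun z _ => ?_
    rw [Real.mul_rpow (inv_pos.2 hn).le (hE.1 _), Real.inv_rpow hn.le, Real.rpow_def_of_pos hn,
      ← Real.exp_neg, mul_comm (Real.log _)]
    ring
  have hadm : ∀ z, P z ≠ 0 → (Fintype.card ι : ℝ)⁻¹ *
      escort α (fun j => ∑ i, P (i, j)) z.2 ≠ 0 := fun z hz =>
    mul_ne_zero (inv_pos.2 hn).ne' ((escort_ne_zero_iff hα.ne' h2 _).2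
      (right_ne_zero_of_mul (marginals_ne_zero hP.1 z hz)))
  have := minDiv_le_escort hα hα1 hP hu hE (Or.inl hadm) (by rw [e]; exact Real.exp_pos _)
  rw [e, Real.log_exp, div_one_sub_mul_order hα hα1] at this
  refine this.trans (EReal.coe_le_coe_iff.2 ?_)
  linarith [entropy_snd_le hα hα1 hP]

theorem exists_minDiv_eq_coe {α : ℝ} (hα : 0 < α) {P : ι × κ → ℝ}
    (hP : P ∈ stdSimplex ℝ (ι × κ)) : ∃ k : ℝ, minDiv α P = k := by
  rcases eq_or_ne α 1 with rfl | hα1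
  · exact ⟨_, minDiv_one hP⟩
  · have h1 := minDiv_nonneg hα hP
    have h2 := minDiv_le_log_card_of_ne hα hα1 hP
    exact ⟨(minDiv α P).toReal, (EReal.coe_toReal (h2.trans_lt (EReal.coe_lt_top _)).ne
      (EReal.bot_lt_zero.trans_le h1).ne').symm⟩

end EntropyBounds

/-! ### Additivity for independent pairs, away from order one. -/

section Additivity

variable {ι₁ ι₂ κ₁ κ₂ : Type*} [Fintype ι₁] [Fintype ι₂] [Fintype κ₁] [Fintype κ₂]

/-- The joint mass function of two independent pairs, with the coordinates regrouped. -/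
def tensor (P₁ : ι₁ × κ₁ → ℝ) (P₂ : ι₂ × κ₂ → ℝ) : (ι₁ × ι₂) × (κ₁ × κ₂) → ℝ :=
  fun z => P₁ (z.1.1, z.2.1) * P₂ (z.1.2, z.2.2)

theorem sum_regroup (F : (ι₁ × ι₂) × (κ₁ × κ₂) → ℝ) :
    ∑ z, F z = ∑ a : ι₁ × κ₁, ∑ b : ι₂ × κ₂, F ((a.1, b.1), (a.2, b.2)) := by
  rw [← Fintype.sum_prod_type' fun (a : ι₁ × κ₁) (b : ι₂ × κ₂) => F ((a.1, b.1), (a.2, b.2))]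
  exact Fintype.sum_equiv (Equiv.prodProdProdComm ι₁ ι₂ κ₁ κ₂) _ _ fun _ => rfl

theorem tensor_mem {P₁ : ι₁ × κ₁ → ℝ} {P₂ : ι₂ × κ₂ → ℝ} (h₁ : P₁ ∈ stdSimplex ℝ (ι₁ × κ₁))
    (h₂ : P₂ ∈ stdSimplex ℝ (ι₂ × κ₂)) :
    tensor P₁ P₂ ∈ stdSimplex ℝ ((ι₁ × ι₂) × (κ₁ × κ₂)) :=
  ⟨fun _ => mul_nonneg (h₁.1 _) (h₂.1 _), by
    rw [sum_regroup]
    simp only [tensor, Prod.mk.eta]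
    rw [← Finset.sum_mul_sum, h₁.2, h₂.2, one_mul]⟩

theorem entropy_tensor {α : ℝ} (hα1 : α ≠ 1) {P₁ : ι₁ × κ₁ → ℝ} {P₂ : ι₂ × κ₂ → ℝ}
    (h₁ : P₁ ∈ stdSimplex ℝ (ι₁ × κ₁)) (h₂ : P₂ ∈ stdSimplex ℝ (ι₂ × κ₂)) :
    entropy α (tensor P₁ P₂) = entropy α P₁ + entropy α P₂ := by
  rw [entropy_of_ne hα1, entropy_of_ne hα1, entropy_of_ne hα1, sum_regroup]
  simp only [tensor, Prod.mk.eta]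
  simp_rw [fun a b => Real.mul_rpow (h₁.1 a) (h₂.1 b) (z := α)]
  rw [← Finset.sum_mul_sum, Real.log_mul (sum_rpow_pos h₁ α).ne' (sum_rpow_pos h₂ α).ne']
  ring

theorem div_sum_mem {ι : Type*} [Fintype ι] {u : ι → ℝ} (hu : ∀ i, 0 ≤ u i)
    (hU : 0 < ∑ i, u i) : (fun i => u i / ∑ j, u j) ∈ stdSimplex ℝ ι :=
  ⟨fun i => div_nonneg (hu i) hU.le, by rw [← Finset.sum_div, div_self hU.ne']⟩

theorem sum_mul_rpow_normalize {ι κ : Type*} [Fintype ι] [Fintype κ] (P : ι × κ → ℝ)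
    {u : ι → ℝ} {v : κ → ℝ} (hu : ∀ i, 0 ≤ u i) (hv : ∀ j, 0 ≤ v j) (hU : 0 < ∑ i, u i)
    (hV : 0 < ∑ j, v j) (s : ℝ) :
    ∑ z, P z * (u z.1 * v z.2) ^ s = (∑ z, P z * (u z.1 / (∑ i, u i) * (v z.2 / ∑ j, v j)) ^ s) *
      ((∑ i, u i) * ∑ j, v j) ^ s := by
  have hUV := mul_pos hU hV
  rw [Finset.sum_mul]
  refine Finset.sum_congr rfl fun z _ => ?_
  rw [div_mul_div_comm, Real.div_rpow (mul_nonneg (hu _) (hv _)) hUV.le, mul_assoc,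
    div_mul_cancel₀ _ (Real.rpow_pos_of_pos hUV s).ne']

/-- By homogeneity the bound extends to unnormalised vectors, which is needed for slices of `r` and
`t`. If a total mass vanishes, both sides are zero because `s > 0`. -/
theorem sum_mul_rpow_le_scaled {ι κ : Type*} [Fintype ι] [Fintype κ] {P : ι × κ → ℝ} {s g : ℝ}
    (hs : 0 < s) (h : ∀ r ∈ stdSimplex ℝ ι, ∀ t ∈ stdSimplex ℝ κ,
      ∑ z, P z * (r z.1 * t z.2) ^ s ≤ g)
    {u : ι → ℝ} {v : κ → ℝ} (hu : ∀ i, 0 ≤ u i) (hv : ∀ j, 0 ≤ v j) :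
    ∑ z, P z * (u z.1 * v z.2) ^ s ≤ g * ((∑ i, u i) * ∑ j, v j) ^ s := by
  rcases (Finset.sum_nonneg fun i (_ : i ∈ Finset.univ) => hu i).eq_or_lt with hU | hU
  · have h0 : ∀ i, u i = 0 := fun i =>
      (Finset.sum_eq_zero_iff_of_nonneg fun i _ => hu i).1 hU.symm i (Finset.mem_univ i)
    simp [h0, Real.zero_rpow hs.ne']
  rcases (Finset.sum_nonneg fun i (_ : i ∈ Finset.univ) => hv i).eq_or_lt with hV | hV
  · have h0 : ∀ i, v i = 0 := fun i =>
      (Finset.sum_eq_zero_iff_of_nonneg fun i _ => hv i).1 hV.symm i (Finset.mem_univ i)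
    simp [h0, Real.zero_rpow hs.ne']
  rw [sum_mul_rpow_normalize P hu hv hU hV]
  exact mul_le_mul_of_nonneg_right (h _ (div_sum_mem hu hU) _ (div_sum_mem hv hV))
    (Real.rpow_nonneg (mul_pos hU hV).le s)

/-- Here absolute continuity with respect to `u v` makes both total masses positive, so
normalisation is always possible. -/
theorem le_sum_mul_rpow_scaled {ι κ : Type*} [Fintype ι] [Fintype κ] {P : ι × κ → ℝ} {s g : ℝ}
    (hP : P ∈ stdSimplex ℝ (ι × κ)) (h : ∀ r ∈ stdSimplex ℝ ι, ∀ t ∈ stdSimplex ℝ κ,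
      (∀ z, P z ≠ 0 → r z.1 * t z.2 ≠ 0) → g ≤ ∑ z, P z * (r z.1 * t z.2) ^ s)
    {u : ι → ℝ} {v : κ → ℝ} (hu : ∀ i, 0 ≤ u i) (hv : ∀ j, 0 ≤ v j)
    (hac : ∀ z, P z ≠ 0 → u z.1 * v z.2 ≠ 0) :
    g * ((∑ i, u i) * ∑ j, v j) ^ s ≤ ∑ z, P z * (u z.1 * v z.2) ^ s := by
  obtain ⟨z, hz⟩ := exists_pos_of_mem_stdSimplex hP
  have huz : 0 < u z.1 := lt_of_le_of_ne (hu _) (left_ne_zero_of_mul (hac z hz.ne')).symm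
  have hvz : 0 < v z.2 := lt_of_le_of_ne (hv _) (right_ne_zero_of_mul (hac z hz.ne')).symm
  have hU : 0 < ∑ i, u i := huz.trans_le
    (Finset.single_le_sum (f := u) (fun i _ => hu i) (Finset.mem_univ z.1))
  have hV : 0 < ∑ i, v i := hvz.trans_le
    (Finset.single_le_sum (f := v) (fun i _ => hv i) (Finset.mem_univ z.2))
  rw [sum_mul_rpow_normalize P hu hv hU hV]
  refine mul_le_mul_of_nonneg_right (h _ (div_sum_mem hu hU) _ (div_sum_mem hv hV) fun z hz => ?_)
    (Real.rpow_nonneg (mul_pos hU hV).le s)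
  rw [div_mul_div_comm]
  exact div_ne_zero (hac z hz) (mul_pos hU hV).ne'

theorem sum_tensor_mul_rpow (P₁ : ι₁ × κ₁ → ℝ) (P₂ : ι₂ × κ₂ → ℝ) (r : ι₁ × ι₂ → ℝ)
    (t : κ₁ × κ₂ → ℝ) (s : ℝ) :
    ∑ z, tensor P₁ P₂ z * (r z.1 * t z.2) ^ s =
      ∑ a, P₁ a * ∑ b, P₂ b * (r (a.1, b.1) * t (a.2, b.2)) ^ s := by
  rw [sum_regroup]
  simp only [tensor, Prod.mk.eta, Finset.mul_sum, mul_assoc]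

theorem marginals_ne_zero_of_slice {r : ι₁ × ι₂ → ℝ} {t : κ₁ × κ₂ → ℝ} (hr : ∀ i, 0 ≤ r i)
    (ht : ∀ j, 0 ≤ t j) {a : ι₁ × κ₁} {b : ι₂ × κ₂} (h : r (a.1, b.1) * t (a.2, b.2) ≠ 0) :
    (∑ i, r (a.1, i)) * ∑ j, t (a.2, j) ≠ 0 := by
  have h1 := lt_of_le_of_ne (hr _) (left_ne_zero_of_mul h).symm
  have h2 := lt_of_le_of_ne (ht _) (right_ne_zero_of_mul h).symm
  exact (mul_pos (h1.trans_le (le_marginals hr _).1) (h2.trans_le (le_marginals ht _).1)).ne'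

theorem exists_optimal_escort {ι κ : Type*} [Fintype ι] [Fintype κ] {α : ℝ} (hα : 0 < α)
    (hα1 : α ≠ 1) {P : ι × κ → ℝ} (hP : P ∈ stdSimplex ℝ (ι × κ)) {k : ℝ}
    (hk : minDiv α P = k) : ∃ r ∈ stdSimplex ℝ ι, ∃ t ∈ stdSimplex ℝ κ,
      ((∀ z, P z ≠ 0 → r z.1 * t z.2 ≠ 0) ∨ 1 < α) ∧
      ∑ z, P z * (r z.1 * t z.2) ^ ((α - 1) / α) =
        Real.exp (-((α - 1) / α * (k + entropy α P))) := by
  obtain ⟨r, hr, t, ht, h⟩ := exists_relAlphaEntropy_eq_minDiv hα hP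
  have hr' := escort_mem (a := α) hr
  have ht' := escort_mem (a := α) ht
  refine ⟨_, hr', _, ht', sum_eq_of_relAlphaEntropy_escort_eq hα hα1 hP (prod_mem hr' ht') ?_⟩
  rw [escort_prod _ hr'.1 ht'.1, escort_escort (mul_one_div_cancel hα.ne') hr,
    escort_escort (mul_one_div_cancel hα.ne') ht, h, hk]

/-- For fixed values `a` of the first pair, bound the inner moment by applying the second hypothesis
to the slices of `r` and `t`. What remains involves the slice totals, which are marginals of `r` and
`t`, so the first hypothesis applies. -/
theorem le_minDiv_tensor {α : ℝ} (hα : 0 < α) (hα1 : α ≠ 1) {P₁ : ι₁ × κ₁ → ℝ}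
    {P₂ : ι₂ × κ₂ → ℝ} (h₁ : P₁ ∈ stdSimplex ℝ (ι₁ × κ₁)) (h₂ : P₂ ∈ stdSimplex ℝ (ι₂ × κ₂))
    {k₁ k₂ : ℝ} (hk₁ : (k₁ : EReal) ≤ minDiv α P₁) (hk₂ : (k₂ : EReal) ≤ minDiv α P₂) :
    ((k₁ + k₂ : ℝ) : EReal) ≤ minDiv α (tensor P₁ P₂) := by
  have hexp : Real.exp (-((α - 1) / α * (k₁ + k₂ + entropy α (tensor P₁ P₂)))) =
      Real.exp (-((α - 1) / α * (k₂ + entropy α P₂))) *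
        Real.exp (-((α - 1) / α * (k₁ + entropy α P₁))) := by
    rw [entropy_tensor hα1 h₁ h₂, ← Real.exp_add]
    congr 1
    ring
  have swap : ∀ (g s : ℝ) (r : ι₁ × ι₂ → ℝ) (t : κ₁ × κ₂ → ℝ),
      ∑ a : ι₁ × κ₁, P₁ a * (g * ((∑ i, r (a.1, i)) * ∑ j, t (a.2, j)) ^ s) =
        g * ∑ a : ι₁ × κ₁, P₁ a * ((∑ i, r (a.1, i)) * ∑ j, t (a.2, j)) ^ s := fun g s r t => by
    rw [Finset.mul_sum]
    exact Finset.sum_congr rfl fun a _ => by ring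
  rcases lt_or_gt_of_ne hα1 with hlt | hgt
  · rw [le_minDiv_iff_of_lt_one hα hlt h₁] at hk₁
    rw [le_minDiv_iff_of_lt_one hα hlt h₂] at hk₂
    rw [le_minDiv_iff_of_lt_one hα hlt (tensor_mem h₁ h₂), hexp]
    intro r hr t ht hac
    have hac' : ∀ a, P₁ a ≠ 0 → ∀ b, P₂ b ≠ 0 → r (a.1, b.1) * t (a.2, b.2) ≠ 0 :=
      fun a ha b hb => hac ((a.1, b.1), (a.2, b.2)) (mul_ne_zero ha hb)
    obtain ⟨b, hb⟩ := exists_pos_of_mem_stdSimplex h₂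
    have hm := hk₁ _ (marginals_mem hr).1 _ (marginals_mem ht).1 fun a ha =>
      marginals_ne_zero_of_slice hr.1 ht.1 (hac' a ha b hb.ne')
    calc _ ≤ _ := mul_le_mul_of_nonneg_left hm (Real.exp_pos _).le
      _ = _ := (swap _ _ r t).symm
      _ ≤ ∑ a, P₁ a * ∑ b, P₂ b * (r (a.1, b.1) * t (a.2, b.2)) ^ ((α - 1) / α) := by
        refine Finset.sum_le_sum fun a _ => ?_
        rcases eq_or_ne (P₁ a) 0 with h0 | h0
        · simp [h0]
        · exact mul_le_mul_of_nonneg_left (le_sum_mul_rpow_scaled h₂ hk₂ (fun i => hr.1 _)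
            (fun j => ht.1 _) (hac' a h0)) (h₁.1 a)
      _ = _ := (sum_tensor_mul_rpow P₁ P₂ r t _).symm
  · rw [le_minDiv_iff_of_one_lt hgt h₁] at hk₁
    rw [le_minDiv_iff_of_one_lt hgt h₂] at hk₂
    rw [le_minDiv_iff_of_one_lt hgt (tensor_mem h₁ h₂), hexp]
    intro r hr t ht
    have hs : 0 < (α - 1) / α := div_pos (by linarith) hα
    have hm := hk₁ _ (marginals_mem hr).1 _ (marginals_mem ht).1
    calc _ = ∑ a, P₁ a * ∑ b, P₂ b * (r (a.1, b.1) * t (a.2, b.2)) ^ ((α - 1) / α) :=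
          sum_tensor_mul_rpow P₁ P₂ r t _
      _ ≤ _ := Finset.sum_le_sum fun a _ => mul_le_mul_of_nonneg_left
          (sum_mul_rpow_le_scaled hs hk₂ (fun i => hr.1 (a.1, i)) fun j => ht.1 (a.2, j)) (h₁.1 a)
      _ = _ := swap _ _ r t
      _ ≤ _ := mul_le_mul_of_nonneg_left hm (Real.exp_pos _).le

/-- The product of the two optimisers is a competitor whose moment factorises. -/
theorem minDiv_tensor_le {α : ℝ} (hα : 0 < α) (hα1 : α ≠ 1) {P₁ : ι₁ × κ₁ → ℝ}
    {P₂ : ι₂ × κ₂ → ℝ} (h₁ : P₁ ∈ stdSimplex ℝ (ι₁ × κ₁)) (h₂ : P₂ ∈ stdSimplex ℝ (ι₂ × κ₂))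
    {k₁ k₂ : ℝ} (hk₁ : minDiv α P₁ = k₁) (hk₂ : minDiv α P₂ = k₂) :
    minDiv α (tensor P₁ P₂) ≤ ((k₁ + k₂ : ℝ) : EReal) := by
  obtain ⟨r₁, hr₁, t₁, ht₁, had₁, e₁⟩ := exists_optimal_escort hα hα1 h₁ hk₁
  obtain ⟨r₂, hr₂, t₂, ht₂, had₂, e₂⟩ := exists_optimal_escort hα hα1 h₂ hk₂
  have e : ∑ z, tensor P₁ P₂ z * ((r₁ z.1.1 * r₂ z.1.2) * (t₁ z.2.1 * t₂ z.2.2)) ^ ((α - 1) / α) =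
      Real.exp (-((α - 1) / α * (k₁ + k₂ + entropy α (tensor P₁ P₂)))) := by
    have h := sum_tensor_mul_rpow P₁ P₂ (fun i => r₁ i.1 * r₂ i.2) (fun j => t₁ j.1 * t₂ j.2)
      ((α - 1) / α)
    have h' : Real.exp (-((α - 1) / α * (k₁ + k₂ + entropy α (tensor P₁ P₂)))) =
      Real.exp (-((α - 1) / α * (k₁ + entropy α P₁))) *
        Real.exp (-((α - 1) / α * (k₂ + entropy α P₂))) := by
      rw [entropy_tensor hα1 h₁ h₂, ← Real.exp_add]
      congr 1
      ring
    rw [h, h', ← e₁, ← e₂, Finset.sum_mul_sum]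
    refine Finset.sum_congr rfl fun a _ => ?_
    rw [Finset.mul_sum]
    refine Finset.sum_congr rfl fun b _ => ?_
    rw [mul_mul_mul_comm, Real.mul_rpow (mul_nonneg (hr₁.1 _) (ht₁.1 _))
      (mul_nonneg (hr₂.1 _) (ht₂.1 _))]
    ring
  have had : (∀ z, tensor P₁ P₂ z ≠ 0 →
      (r₁ z.1.1 * r₂ z.1.2) * (t₁ z.2.1 * t₂ z.2.2) ≠ 0) ∨ 1 < α := by
    rcases had₁ with h | h
    · rcases had₂ with h' | h'
      · refine Or.inl fun z hz => ?_
        rw [mul_mul_mul_comm]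
        exact mul_ne_zero (h _ (left_ne_zero_of_mul hz)) (h' _ (right_ne_zero_of_mul hz))
      · exact Or.inr h'
    · exact Or.inr h
  have := minDiv_le_escort hα hα1 (tensor_mem h₁ h₂) (prod_mem hr₁ hr₂) (prod_mem ht₁ ht₂) had
    (by rw [e]; exact Real.exp_pos _)
  rw [e, Real.log_exp, div_one_sub_mul_order hα hα1] at this
  simpa using this

theorem minDiv_tensor_of_ne {α : ℝ} (hα : 0 < α) (hα1 : α ≠ 1) {P₁ : ι₁ × κ₁ → ℝ}
    {P₂ : ι₂ × κ₂ → ℝ} (h₁ : P₁ ∈ stdSimplex ℝ (ι₁ × κ₁))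
    (h₂ : P₂ ∈ stdSimplex ℝ (ι₂ × κ₂)) :
    minDiv α (tensor P₁ P₂) = minDiv α P₁ + minDiv α P₂ := by
  obtain ⟨k₁, hk₁⟩ := exists_minDiv_eq_coe hα h₁
  obtain ⟨k₂, hk₂⟩ := exists_minDiv_eq_coe hα h₂
  rw [hk₁, hk₂, ← EReal.coe_add]
  exact le_antisymm (minDiv_tensor_le hα hα1 h₁ h₂ hk₁ hk₂)
    (le_minDiv_tensor hα hα1 h₁ h₂ hk₁.ge hk₂.ge)

end Additivity

/-! ### Continuity at order one and passage to the limit. -/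

section OrderOne

variable {ι κ : Type*} [Fintype ι] [Fintype κ]

/-- Since `∑ p ^ α = ∑ p * p ^ (α - 1)`, the Rényi entropy is minus the slope at zero of a
log-moment of `p` under itself. -/
theorem continuousAt_entropy_one {p : ι → ℝ} (hp : p ∈ stdSimplex ℝ ι) :
    ContinuousAt (fun α => entropy α p) 1 := by
  rw [continuousAt_iff_punctured_nhds, entropy_one]
  have hsub : Tendsto (fun α : ℝ => α - 1) (𝓝[≠] 1) (𝓝[≠] 0) := by
    refine tendsto_nhdsWithin_iff.2 ⟨?_, ?_⟩
    · have : Tendsto (fun α : ℝ => α - 1) (𝓝 1) (𝓝 (1 - 1)) := tendsto_id.sub_const 1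
      rw [sub_self] at this
      exact this.mono_left nhdsWithin_le_nhds
    · filter_upwards [self_mem_nhdsWithin] with α hα
      exact sub_ne_zero.2 hα
  have h := ((tendsto_log_sum_mul_rpow hp hp.1 fun _ h => h).comp hsub).neg
  refine h.congr' ?_
  filter_upwards [self_mem_nhdsWithin, nhdsWithin_le_nhds (lt_mem_nhds one_pos)] with α hα hpos
  have hα : α ≠ 1 := hα
  have : 1 - α ≠ 0 := sub_ne_zero.2 hα.symm
  have : α - 1 ≠ 0 := sub_ne_zero.2 hα
  rw [entropy_of_ne hα, Finset.sum_congr rfl fun i _ => rpow_eq_mul_rpow_sub_one hpos (hp.1 i)]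
  simp only [Function.comp]
  rw [one_div, ← neg_sub α 1, inv_neg, neg_mul]

/-- Upper half of the squeeze at order one: the marginals are used as `r` and `t`, and the bound has
the slope form whose limit is known. -/
theorem minDiv_le_of_marginals {α : ℝ} (hα : 0 < α) (hα1 : α ≠ 1) {P : ι × κ → ℝ}
    (hP : P ∈ stdSimplex ℝ (ι × κ)) :
    minDiv α P ≤ ((-((α - 1) / α)⁻¹ * Real.log (∑ z, P z *
      ((∑ j, P (z.1, j)) * ∑ i, P (i, z.2)) ^ ((α - 1) / α)) - entropy α P : ℝ) : EReal) := by
  obtain ⟨h1, h2⟩ := marginals_mem hP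
  have := minDiv_le_escort hα hα1 hP h1 h2 (Or.inl (marginals_ne_zero hP.1))
    (sum_mul_rpow_pos hP (fun z => mul_nonneg (h1.1 z.1) (h2.1 z.2)) (marginals_ne_zero hP.1) _)
  convert this using 4
  rw [inv_div, ← div_neg, neg_sub]

/-- Jensen's inequality bounds the moment below by `exp (s ∑ P log (r t))`; since `s < 0`, Gibbs'
upper bound on the logarithmic mean yields the claim. -/
theorem le_minDiv_of_lt_one {α : ℝ} (hα : 0 < α) (hα1 : α < 1) {P : ι × κ → ℝ}
    (hP : P ∈ stdSimplex ℝ (ι × κ)) :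
    ((entropy 1 (fun i => ∑ j, P (i, j)) + entropy 1 (fun j => ∑ i, P (i, j)) - entropy α P : ℝ) :
      EReal) ≤ minDiv α P := by
  rw [le_minDiv_iff_of_lt_one hα hα1 hP, sub_add_cancel]
  intro r hr t ht hac
  refine le_trans (Real.exp_le_exp.2 ?_) (exp_mul_sum_log_le_sum_mul_rpow hP
    (fun z => mul_nonneg (hr.1 z.1) (ht.1 z.2)) hac ((α - 1) / α))
  have h := mul_le_mul_of_nonpos_left (sum_mul_log_prod_le hP hr ht hac)
    (div_neg_of_neg_of_pos (by linarith) hα : (α - 1) / α < 0).le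
  linarith

/-- Cauchy-Schwarz under `P` separates `r` from `t` and doubles the exponent. Here `2 s` is the
exponent belonging to order `α / (2 - α)`, so Hölder applies to each marginal; this order tends to
one with `α`. -/
theorem le_minDiv_of_one_lt {α : ℝ} (hα1 : 1 < α) (hα2 : α < 2) {P : ι × κ → ℝ}
    (hP : P ∈ stdSimplex ℝ (ι × κ)) :
    ((entropy (α / (2 - α)) (fun i => ∑ j, P (i, j)) +
      entropy (α / (2 - α)) (fun j => ∑ i, P (i, j)) - entropy α P : ℝ) : EReal) ≤
      minDiv α P := by
  rw [le_minDiv_iff_of_one_lt hα1 hP, sub_add_cancel]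
  intro r hr t ht
  obtain ⟨h1, h2⟩ := marginals_mem hP
  have hα : 0 < α := by linarith
  have hγ : 1 < α / (2 - α) := (one_lt_div (by linarith)).2 (by linarith)
  have hs : (α / (2 - α) - 1) / (α / (2 - α)) = 2 * ((α - 1) / α) := by
    have : 2 - α ≠ 0 := by linarith
    field_simp
    ring
  have b1 := sum_mul_rpow_le_exp hγ h1 hr.1 hr.2.le
  have b2 := sum_mul_rpow_le_exp hγ h2 ht.1 ht.2.le
  rw [← sum_mul_fst P fun i => r i ^ _] at b1
  rw [← sum_mul_snd P fun j => t j ^ _] at b2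
  rw [hs] at b1 b2
  have sq : ∀ {x s : ℝ}, 0 ≤ x → x ^ (2 * s) = (x ^ s) ^ 2 := fun hx => by
    rw [mul_comm, Real.rpow_mul hx, Real.rpow_two]
  calc ∑ z, P z * (r z.1 * t z.2) ^ ((α - 1) / α)
      = ∑ z, √(P z * r z.1 ^ (2 * ((α - 1) / α))) * √(P z * t z.2 ^ (2 * ((α - 1) / α))) := by
        refine Finset.sum_congr rfl fun z _ => ?_
        rw [sq (hr.1 _), sq (ht.1 _), Real.sqrt_mul (hP.1 z), Real.sqrt_mul (hP.1 z),
          Real.sqrt_sq (Real.rpow_nonneg (hr.1 _) _), Real.sqrt_sq (Real.rpow_nonneg (ht.1 _) _),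
          mul_mul_mul_comm, Real.mul_self_sqrt (hP.1 z), Real.mul_rpow (hr.1 _) (ht.1 _)]
    _ ≤ √(∑ z, P z * r z.1 ^ (2 * ((α - 1) / α))) * √(∑ z, P z * t z.2 ^ (2 * ((α - 1) / α))) :=
        Real.sum_sqrt_mul_sqrt_le _
          (fun z => mul_nonneg (hP.1 z) (Real.rpow_nonneg (hr.1 _) _))
          (fun z => mul_nonneg (hP.1 z) (Real.rpow_nonneg (ht.1 _) _))
    _ ≤ √(Real.exp (-(2 * ((α - 1) / α) * _))) * √(Real.exp (-(2 * ((α - 1) / α) * _))) :=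
        mul_le_mul (Real.sqrt_le_sqrt b1) (Real.sqrt_le_sqrt b2) (Real.sqrt_nonneg _)
          (Real.sqrt_nonneg _)
    _ = _ := by
        rw [← Real.exp_half, ← Real.exp_half, ← Real.exp_add]
        congr 1
        ring

theorem continuousAt_div_two_sub : ContinuousAt (fun α : ℝ => α / (2 - α)) 1 :=
  continuousAt_id.div (continuousAt_const.sub continuousAt_id) (by norm_num)

theorem continuousAt_entropy_div_two_sub {p : ι → ℝ} (hp : p ∈ stdSimplex ℝ ι) :
    ContinuousAt (fun α : ℝ => entropy (α / (2 - α)) p) 1 := by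
  have h1 : (1 : ℝ) / (2 - 1) = 1 := by norm_num
  refine ContinuousAt.comp (g := fun γ => entropy γ p) (f := fun α : ℝ => α / (2 - α)) ?_
    continuousAt_div_two_sub
  rw [h1]
  exact continuousAt_entropy_one hp

theorem eventually_near_one : ∀ᶠ α : ℝ in 𝓝[≠] 1, 0 < α ∧ α < 2 ∧ α ≠ 1 := by
  filter_upwards [self_mem_nhdsWithin, nhdsWithin_le_nhds (lt_mem_nhds one_pos),
    nhdsWithin_le_nhds (gt_mem_nhds one_lt_two)] with α h1 h2 h3
  exact ⟨h2, h3, h1⟩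

theorem continuousAt_minDiv_one {P : ι × κ → ℝ} (hP : P ∈ stdSimplex ℝ (ι × κ)) :
    ContinuousAt (fun α => minDiv α P) 1 := by
  obtain ⟨h1, h2⟩ := marginals_mem hP
  rw [continuousAt_iff_punctured_nhds, minDiv_one hP]
  have hH := (continuousAt_entropy_one hP).tendsto.mono_left
    (nhdsWithin_le_nhds (s := ({1}ᶜ : Set ℝ)))
  have hord : Tendsto (fun α : ℝ => (α - 1) / α) (𝓝[≠] 1) (𝓝[≠] 0) := by
    refine tendsto_nhdsWithin_iff.2 ⟨?_, ?_⟩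
    · have : ContinuousAt (fun α : ℝ => (α - 1) / α) 1 :=
        (continuousAt_id.sub continuousAt_const).div continuousAt_id one_ne_zero
      have := this.tendsto
      rw [sub_self, zero_div] at this
      exact this.mono_left nhdsWithin_le_nhds
    · filter_upwards [eventually_near_one] with α hα
      exact div_ne_zero (sub_ne_zero.2 hα.2.2) hα.1.ne'
  have hup := ((tendsto_log_sum_mul_rpow hP (fun z => mul_nonneg (h1.1 z.1) (h2.1 z.2))
    (marginals_ne_zero hP.1)).comp hord).neg.sub hH
  rw [sum_mul_log_prod (r := fun i => ∑ j, P (i, j)) (t := fun j => ∑ i, P (i, j))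
    (marginals_ne_zero hP.1), neg_add, ← entropy_one, ← entropy_one] at hup
  have hle : 𝓝[≠] (1 : ℝ) ≤ 𝓝 1 := nhdsWithin_le_nhds
  -- The minimum of the two lower bounds is valid on both sides of order one, and both have the same
  -- limit.
  have hlo := ((tendsto_const_nhds (x := entropy 1 (fun i => ∑ j, P (i, j)) +
    entropy 1 (fun j => ∑ i, P (i, j)))).min
      (((continuousAt_entropy_div_two_sub h1).tendsto.mono_left hle).add
        ((continuousAt_entropy_div_two_sub h2).tendsto.mono_left hle))).sub hH
  have hone : (1 : ℝ) / (2 - 1) = 1 := by norm_num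
  rw [hone, min_self] at hlo
  refine tendsto_of_tendsto_of_tendsto_of_le_of_le' (EReal.tendsto_coe.2 hlo)
    (EReal.tendsto_coe.2 hup) ?_ ?_
  · filter_upwards [eventually_near_one] with α hα
    rcases lt_or_gt_of_ne hα.2.2 with hlt | hgt
    · exact (EReal.coe_le_coe_iff.2 (sub_le_sub_right (min_le_left _ _) _)).trans
        (le_minDiv_of_lt_one hα.1 hlt hP)
    · exact (EReal.coe_le_coe_iff.2 (sub_le_sub_right (min_le_right _ _) _)).trans
        (le_minDiv_of_one_lt hgt hα.2.1 hP)
  · filter_upwards [eventually_near_one] with α hα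
    have := minDiv_le_of_marginals hα.1 hα.2.2 hP
    rwa [neg_mul] at this

theorem continuousOn_minDiv {P : ι × κ → ℝ} (hP : P ∈ stdSimplex ℝ (ι × κ)) :
    ContinuousOn (fun α => minDiv α P) (Set.Ioi 0) := fun α hα => by
  refine ContinuousAt.continuousWithinAt ?_
  rcases eq_or_ne α 1 with rfl | hα1
  · exact continuousAt_minDiv_one hP
  · exact continuousAt_minDiv hP hα hα1

theorem tendsto_minDiv_one {P : ι × κ → ℝ} (hP : P ∈ stdSimplex ℝ (ι × κ)) :
    Tendsto (fun α => minDiv α P) (𝓝[≠] 1) (𝓝 (minDiv 1 P)) :=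
  continuousAt_iff_punctured_nhds.1 (continuousAt_minDiv_one hP)

theorem minDiv_le_log_card {α : ℝ} (hα : 0 < α) {P : ι × κ → ℝ}
    (hP : P ∈ stdSimplex ℝ (ι × κ)) : minDiv α P ≤ (Real.log (Fintype.card ι) : ℝ) := by
  rcases eq_or_ne α 1 with rfl | hα1
  · refine le_of_tendsto (tendsto_minDiv_one hP) ?_
    filter_upwards [eventually_near_one] with α hα
    exact minDiv_le_log_card_of_ne hα.1 hα.2.2 hP
  · exact minDiv_le_log_card_of_ne hα hα1 hP

theorem minDiv_tensor {ι₁ ι₂ κ₁ κ₂ : Type*} [Fintype ι₁] [Fintype ι₂] [Fintype κ₁] [Fintype κ₂]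
    {α : ℝ} (hα : 0 < α) {P₁ : ι₁ × κ₁ → ℝ} {P₂ : ι₂ × κ₂ → ℝ}
    (h₁ : P₁ ∈ stdSimplex ℝ (ι₁ × κ₁)) (h₂ : P₂ ∈ stdSimplex ℝ (ι₂ × κ₂)) :
    minDiv α (tensor P₁ P₂) = minDiv α P₁ + minDiv α P₂ := by
  rcases eq_or_ne α 1 with rfl | hα1
  · have hadd : Tendsto (fun α => minDiv α P₁ + minDiv α P₂) (𝓝[≠] 1)
        (𝓝 (minDiv 1 P₁ + minDiv 1 P₂)) := by
      refine Tendsto.comp (g := fun p : EReal × EReal => p.1 + p.2) (EReal.continuousAt_add ?_ ?_)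
        ((tendsto_minDiv_one h₁).prodMk_nhds (tendsto_minDiv_one h₂))
      · rw [minDiv_one h₁]; exact Or.inl (EReal.coe_ne_top _)
      · rw [minDiv_one h₁]; exact Or.inl (EReal.coe_ne_bot _)
    refine tendsto_nhds_unique (tendsto_minDiv_one (tensor_mem h₁ h₂)) (hadd.congr' ?_)
    filter_upwards [eventually_near_one] with α hα
    exact (minDiv_tensor_of_ne hα.1 hα.2.2 h₁ h₂).symm
  · exact minDiv_tensor_of_ne hα hα1 h₁ h₂

end OrderOne

/-! ### Closed forms for a pair of identical variables. -/

section Diagonal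

variable {ι : Type*} [Fintype ι]

open Classical in
/-- The joint mass function of a pair of identical random variables. -/
noncomputable def diag (p : ι → ℝ) : ι × ι → ℝ := fun z => if z.1 = z.2 then p z.1 else 0

theorem sum_diag_mul (p : ι → ℝ) (f : ι × ι → ℝ) : ∑ z, diag p z * f z = ∑ i, p i * f (i, i) := by
  rw [Fintype.sum_prod_type]
  refine Finset.sum_congr rfl fun i _ => ?_
  rw [Finset.sum_eq_single i (fun j _ hj => by simp [diag, hj.symm]) (by simp)]
  simp [diag]

theorem diag_mem {p : ι → ℝ} (hp : p ∈ stdSimplex ℝ ι) : diag p ∈ stdSimplex ℝ (ι × ι) := by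
  refine ⟨fun z => ?_, ?_⟩
  · unfold diag
    split_ifs
    exacts [hp.1 _, le_rfl]
  · have := sum_diag_mul p fun _ => 1
    simpa [hp.2] using this

theorem entropy_diag {α : ℝ} (hα : 0 < α) (hα1 : α ≠ 1) (p : ι → ℝ) :
    entropy α (diag p) = entropy α p := by
  rw [entropy_of_ne hα1, entropy_of_ne hα1, Fintype.sum_prod_type]
  congr 2
  refine Finset.sum_congr rfl fun i _ => ?_
  rw [Finset.sum_eq_single i (fun j _ hj => by simp [diag, hj.symm, Real.zero_rpow hα.ne'])
    (by simp)]
  simp [diag]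

omit [Fintype ι] in
theorem diag_ne_zero {p : ι → ℝ} {z : ι × ι} (h : diag p z ≠ 0) : z.1 = z.2 ∧ p z.1 ≠ 0 := by
  by_contra hne
  apply h
  unfold diag
  split_ifs with h1
  · by_contra h2
    exact hne ⟨h1, h2⟩
  · rfl

/-- On the diagonal the moment depends on `r` and `t` only through `w = √(r t)`. By Cauchy-Schwarz
`w` has mass at most one, and `r = t` realises every mass function. -/
theorem sum_sqrt_mul_le_one {r t : ι → ℝ} (hr : r ∈ stdSimplex ℝ ι) (ht : t ∈ stdSimplex ℝ ι) :
    ∑ i, √(r i * t i) ≤ 1 := by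
  simp_rw [fun i => Real.sqrt_mul (hr.1 i) (t i)]
  refine (Real.sum_sqrt_mul_sqrt_le _ hr.1 ht.1).trans ?_
  rw [hr.2, ht.2]
  simp

theorem sqrt_rpow_two_mul {x : ℝ} (hx : 0 ≤ x) (s : ℝ) : √x ^ (2 * s) = x ^ s := by
  rw [Real.rpow_mul (Real.sqrt_nonneg x), Real.rpow_two, Real.sq_sqrt hx]

/-- Since `(r t) ^ s = w ^ (2 * s)` for `w = √(r t)`, this is Hölder's inequality of order `α / (2 -
α)` for `p`, with optimum `r = t` equal to the escort of that order. -/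
theorem minDiv_diag_of_ne {α : ℝ} (hα : 0 < α) (hα1 : α ≠ 1) (hα2 : α < 2) {p : ι → ℝ}
    (hp : p ∈ stdSimplex ℝ ι) :
    minDiv α (diag p) = ((2 * entropy (α / (2 - α)) p - entropy α p : ℝ) : EReal) := by
  have hd : 0 < 2 - α := by linarith
  have hγ : 0 < α / (2 - α) := div_pos hα hd
  have hγ1 : α / (2 - α) ≠ 1 := fun h => hα1 (by rw [div_eq_one_iff_eq hd.ne'] at h; linarith)
  have hs : (α / (2 - α) - 1) / (α / (2 - α)) = 2 * ((α - 1) / α) := by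
    field_simp
    ring
  have hexp : (α - 1) / α * (2 * entropy (α / (2 - α)) p) =
      2 * ((α - 1) / α) * entropy (α / (2 - α)) p := by ring
  apply le_antisymm
  · have hE := escort_mem (a := α / (2 - α)) hp
    have e := sum_mul_escort_eq_exp hγ hγ1 hp
    have e' : ∑ z, diag p z * (escort (α / (2 - α)) p z.1 * escort (α / (2 - α)) p z.2) ^
        ((α - 1) / α) = Real.exp (-((α - 1) / α * (2 * entropy (α / (2 - α)) p))) := by
      rw [sum_diag_mul p fun z : ι × ι => (escort (α / (2 - α)) p z.1 *
        escort (α / (2 - α)) p z.2) ^ ((α - 1) / α), hexp, ← hs, ← e]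
      refine Finset.sum_congr rfl fun i _ => ?_
      rw [hs, ← sqrt_rpow_two_mul (mul_self_nonneg _), Real.sqrt_mul_self (hE.1 i)]
    have := minDiv_le_escort hα hα1 (diag_mem hp) hE hE (Or.inl fun z hz => by
      obtain ⟨h1, h2⟩ := diag_ne_zero hz
      have := (escort_ne_zero_iff hγ.ne' hp z.1).2 h2
      rw [← h1]
      exact mul_ne_zero this this) (by rw [e']; exact Real.exp_pos _)
    rwa [e', Real.log_exp, div_one_sub_mul_order hα hα1, entropy_diag hα hα1] at this
  · rcases lt_or_gt_of_ne hα1 with hlt | hgt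
    · rw [le_minDiv_iff_of_lt_one hα hlt (diag_mem hp), entropy_diag hα hα1, sub_add_cancel]
      intro r hr t ht hac
      have hac' : ∀ i, p i ≠ 0 → r i * t i ≠ 0 := fun i hi => hac (i, i) (by simpa [diag] using hi)
      have hb := exp_le_sum_mul_rpow hγ ((div_lt_one hd).2 (by linarith)) hp
        (fun i => Real.sqrt_nonneg (r i * t i)) (sum_sqrt_mul_le_one hr ht) fun i hi =>
          (Real.sqrt_ne_zero (mul_nonneg (hr.1 i) (ht.1 i))).2 (hac' i hi)
      rw [hs] at hb
      rw [sum_diag_mul p fun z : ι × ι => (r z.1 * t z.2) ^ ((α - 1) / α), hexp]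
      simpa only [fun i => sqrt_rpow_two_mul (mul_nonneg (hr.1 i) (ht.1 i)) ((α - 1) / α)] using hb
    · rw [le_minDiv_iff_of_one_lt hgt (diag_mem hp), entropy_diag hα hα1, sub_add_cancel]
      intro r hr t ht
      have hb := sum_mul_rpow_le_exp (α := α / (2 - α)) ((one_lt_div hd).2 (by linarith)) hp
        (fun i => Real.sqrt_nonneg (r i * t i)) (sum_sqrt_mul_le_one hr ht)
      rw [hs] at hb
      rw [sum_diag_mul p fun z : ι × ι => (r z.1 * t z.2) ^ ((α - 1) / α), hexp]
      simpa only [fun i => sqrt_rpow_two_mul (mul_nonneg (hr.1 i) (ht.1 i)) ((α - 1) / α)] using hb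

theorem minDiv_diag {α : ℝ} (hα : 0 < α) (hα2 : α < 2) {p : ι → ℝ} (hp : p ∈ stdSimplex ℝ ι) :
    minDiv α (diag p) = ((2 * entropy (α / (2 - α)) p - entropy α p : ℝ) : EReal) := by
  rcases eq_or_ne α 1 with rfl | hα1
  · have hc : ContinuousAt (fun α : ℝ => 2 * entropy (α / (2 - α)) p - entropy α p) 1 :=
      (continuousAt_const.mul (continuousAt_entropy_div_two_sub hp)).sub
        (continuousAt_entropy_one hp)
    refine tendsto_nhds_unique (tendsto_minDiv_one (diag_mem hp)) (Tendsto.congr' ?_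
      (EReal.tendsto_coe.2 (continuousAt_iff_punctured_nhds.1 hc)))
    filter_upwards [eventually_near_one] with α hα
    exact (minDiv_diag_of_ne hα.1 hα.2.2 hα.2.1 hp).symm
  · exact minDiv_diag_of_ne hα hα1 hα2 hp

/-- Now `2 * s ≥ 1`, so `w ^ (2 * s) ≤ w` on `[0, 1]` and the moment is at most the largest mass. A
point mass at a mode attains this; it may miss part of the support of `p`, which is harmless because
`α > 1`. -/
theorem minDiv_diag_of_two_le {α : ℝ} (hα2 : 2 ≤ α) {p : ι → ℝ} (hp : p ∈ stdSimplex ℝ ι) :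
    minDiv α (diag p) =
      ((α / (α - 1) * -Real.log (⨆ i, p i) - entropy α p : ℝ) : EReal) := by
  classical
  have hα : 0 < α := by linarith
  have hα1 : 1 < α := by linarith
  obtain ⟨i₀, hi₀⟩ := exists_pos_of_mem_stdSimplex hp
  have hne : Nonempty ι := ⟨i₀⟩
  obtain ⟨m, hm⟩ := exists_eq_ciSup_of_finite (f := p)
  have hle : ∀ i, p i ≤ p m := fun i => by
    rw [hm]; exact le_ciSup (Set.finite_range p).bddAbove i
  have hmpos : 0 < p m := hi₀.trans_le (hle i₀)
  rw [← hm]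
  have hs1 : 1 ≤ 2 * ((α - 1) / α) := by
    rw [← mul_div_assoc, one_le_div hα]; linarith
  apply le_antisymm
  · have hE : (Pi.single m 1 : ι → ℝ) ∈ stdSimplex ℝ ι := single_mem_stdSimplex ℝ m
    have e : ∑ z, diag p z * ((Pi.single m 1 : ι → ℝ) z.1 * (Pi.single m 1 : ι → ℝ) z.2) ^
        ((α - 1) / α) = p m := by
      rw [sum_diag_mul p fun z : ι × ι => ((Pi.single m 1 : ι → ℝ) z.1 *
        (Pi.single m 1 : ι → ℝ) z.2) ^ ((α - 1) / α), Finset.sum_eq_single m]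
      · simp
      · intro i _ hi
        simp [hi, Real.zero_rpow (div_pos (sub_pos.2 hα1) hα).ne']
      · simp
    have := minDiv_le_escort hα hα1.ne' (diag_mem hp) hE hE (Or.inr hα1) (by rw [e]; exact hmpos)
    rw [e, entropy_diag hα hα1.ne'] at this
    convert this using 3
    rw [mul_neg, ← neg_mul, ← div_neg, neg_sub]
  · rw [le_minDiv_iff_of_one_lt hα1 (diag_mem hp), entropy_diag hα hα1.ne', sub_add_cancel]
    intro r hr t ht
    have e : -((α - 1) / α * (α / (α - 1) * -Real.log (p m))) = Real.log (p m) := by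
      have : α - 1 ≠ 0 := by linarith
      field_simp
    rw [e, Real.exp_log hmpos, sum_diag_mul p fun z : ι × ι => (r z.1 * t z.2) ^ ((α - 1) / α)]
    have hsq := sum_sqrt_mul_le_one hr ht
    have hone : ∀ i, √(r i * t i) ≤ 1 := fun i => (Finset.single_le_sum
      (f := fun i => √(r i * t i)) (fun i _ => Real.sqrt_nonneg _) (Finset.mem_univ i)).trans hsq
    calc ∑ i, p i * (r i * t i) ^ ((α - 1) / α) ≤ ∑ i, p m * √(r i * t i) := by
          refine Finset.sum_le_sum fun i _ => mul_le_mul (hle i) ?_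
            (Real.rpow_nonneg (mul_nonneg (hr.1 i) (ht.1 i)) _) hmpos.le
          rw [← sqrt_rpow_two_mul (mul_nonneg (hr.1 i) (ht.1 i))]
          rcases (Real.sqrt_nonneg (r i * t i)).eq_or_lt with h0 | h0
          · rw [← h0, Real.zero_rpow (by linarith)]
          · exact (Real.rpow_le_rpow_of_exponent_ge h0 (hone i) hs1).trans_eq (Real.rpow_one _)
      _ = p m * ∑ i, √(r i * t i) := (Finset.mul_sum _ _ _).symm
      _ ≤ p m := mul_le_of_le_one_right hmpos.le hsq

end Diagonal

/-! ### Laws of finite-valued random variables. -/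

section RandomVariables

variable {Ω ι κ : Type*} [MeasurableSpace Ω] [Fintype ι] [Fintype κ]

/-- The real mass function of a random variable. -/
noncomputable def law (μ : Measure Ω) (Z : Ω → ι) : ι → ℝ := fun i => (pmfOf μ Z i).toReal

theorem sum_measure_preimage_inter (μ : Measure Ω) [MeasurableSpace ι]
    [MeasurableSingletonClass ι] {Z : Ω → ι} (hZ : Measurable Z) (A : Set Ω) :
    ∑ i, μ (Z ⁻¹' {i} ∩ A) = μ A := by
  have hm : ∀ i, MeasurableSet (Z ⁻¹' {i}) := fun i => hZ (measurableSet_singleton i)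
  have h := sum_measure_preimage_singleton (μ := μ.restrict A) Finset.univ fun i _ => hm i
  simpa [Measure.restrict_apply (hm _)] using h

variable (μ : Measure Ω) [IsProbabilityMeasure μ] [MeasurableSpace ι] [MeasurableSingletonClass ι]
  [MeasurableSpace κ] [MeasurableSingletonClass κ]

theorem law_mem {Z : Ω → ι} (hZ : Measurable Z) :
    law μ Z ∈ stdSimplex ℝ ι ∧ pmfOf μ Z = lift (law μ Z) :=
  exists_lift_eq_of_sum_eq_one (by
    have := sum_measure_preimage_inter μ hZ Set.univ
    simpa [pmfOf] using this)

omit [MeasurableSpace Ω] [Fintype ι] [Fintype κ] [MeasurableSpace ι]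
  [MeasurableSingletonClass ι] [MeasurableSpace κ] [MeasurableSingletonClass κ] in
theorem pair_preimage (X : Ω → ι) (Y : Ω → κ) (i : ι) (j : κ) :
    (fun ω => (X ω, Y ω)) ⁻¹' {(i, j)} = X ⁻¹' {i} ∩ Y ⁻¹' {j} := by
  ext ω
  simp

omit [Fintype ι] [MeasurableSpace ι] [MeasurableSingletonClass ι] in
theorem law_fst {X : Ω → ι} {Y : Ω → κ} (hY : Measurable Y) (i : ι) :
    ∑ j, law μ (fun ω => (X ω, Y ω)) (i, j) = law μ X i := by
  simp only [law, pmfOf, pair_preimage]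
  rw [← ENNReal.toReal_sum fun _ _ => measure_ne_top _ _]
  simp only [Set.inter_comm (X ⁻¹' _)]
  rw [sum_measure_preimage_inter μ hY]

omit [Fintype κ] [MeasurableSpace κ] [MeasurableSingletonClass κ] in
theorem law_snd {X : Ω → ι} {Y : Ω → κ} (hX : Measurable X) (j : κ) :
    ∑ i, law μ (fun ω => (X ω, Y ω)) (i, j) = law μ Y j := by
  simp only [law, pmfOf, pair_preimage]
  rw [← ENNReal.toReal_sum fun _ _ => measure_ne_top _ _, sum_measure_preimage_inter μ hX]

/-- On a finite product with measurable singletons a measure is determined by its point masses, so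
factorisation on points already gives independence. -/
theorem indepFun_iff_law {X : Ω → ι} {Y : Ω → κ} (hX : Measurable X) (hY : Measurable Y) :
    IndepFun X Y μ ↔ ∀ z, law μ (fun ω => (X ω, Y ω)) z = law μ X z.1 * law μ Y z.2 := by
  have h : ∀ z : ι × κ, law μ (fun ω => (X ω, Y ω)) z = law μ X z.1 * law μ Y z.2 ↔
      μ (X ⁻¹' {z.1} ∩ Y ⁻¹' {z.2}) = μ (X ⁻¹' {z.1}) * μ (Y ⁻¹' {z.2}) := fun z => by
    obtain ⟨i, j⟩ := z
    simp only [law, pmfOf, pair_preimage, ← ENNReal.toReal_mul]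
    rw [ENNReal.toReal_eq_toReal_iff' (measure_ne_top _ _)
      (ENNReal.mul_ne_top (measure_ne_top _ _) (measure_ne_top _ _))]
  simp only [h]
  constructor
  · intro hI z
    exact hI.measure_inter_preimage_eq_mul _ _ (measurableSet_singleton _)
      (measurableSet_singleton _)
  · intro hz
    rw [indepFun_iff_map_prod_eq_prod_map_map hX.aemeasurable hY.aemeasurable]
    refine Measure.ext_of_singleton fun z => ?_
    rw [Measure.map_apply (hX.prodMk hY) (measurableSet_singleton z),
      ← Set.singleton_prod_singleton, Measure.prod_prod,
      Measure.map_apply hX (measurableSet_singleton _),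
      Measure.map_apply hY (measurableSet_singleton _), ← hz z, Set.mk_preimage_prod]

theorem K_eq_minDiv {X : Ω → ι} {Y : Ω → κ} (hX : Measurable X) (hY : Measurable Y) (α : ℝ) :
    K μ α X Y = minDiv α (law μ fun ω => (X ω, Y ω)) := by
  rw [K, (law_mem μ (hX.prodMk hY)).2]
  rfl

omit [IsProbabilityMeasure μ] [Fintype ι] [MeasurableSpace ι] [MeasurableSingletonClass ι] in
theorem law_self (X : Ω → ι) : law μ (fun ω => (X ω, X ω)) = diag (law μ X) := by
  funext ⟨i, j⟩
  simp only [law, pmfOf, diag, pair_preimage]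
  split_ifs with h
  · rw [h, Set.inter_self]
  · have : X ⁻¹' {i} ∩ X ⁻¹' {j} = ∅ := by
      ext ω
      simp only [Set.mem_inter_iff, Set.mem_preimage, Set.mem_singleton_iff,
        Set.mem_empty_iff_false, iff_false]
      rintro ⟨h1, h2⟩
      exact h (h1.symm.trans h2)
    rw [this, measure_empty, ENNReal.toReal_zero]

omit [IsProbabilityMeasure μ] [Fintype ι] [Fintype κ] [MeasurableSpace ι]
  [MeasurableSingletonClass ι] [MeasurableSpace κ] [MeasurableSingletonClass κ] in
theorem law_swap (X : Ω → ι) (Y : Ω → κ) :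
    law μ (fun ω => (Y ω, X ω)) = fun z => law μ (fun ω => (X ω, Y ω)) z.swap := by
  funext z
  simp only [law, pmfOf]
  rw [show z.swap = (z.2, z.1) from rfl, show z = (z.1, z.2) from rfl, pair_preimage,
    pair_preimage, Set.inter_comm]

theorem law_tensor {ι₂ κ₂ : Type*} [Fintype ι₂] [MeasurableSpace ι₂] [MeasurableSingletonClass ι₂]
    [Fintype κ₂] [MeasurableSpace κ₂] [MeasurableSingletonClass κ₂]
    {X₁ : Ω → ι} {Y₁ : Ω → κ} {X₂ : Ω → ι₂} {Y₂ : Ω → κ₂} (hX₁ : Measurable X₁)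
    (hY₁ : Measurable Y₁) (hX₂ : Measurable X₂) (hY₂ : Measurable Y₂)
    (h : IndepFun (fun ω => (X₁ ω, Y₁ ω)) (fun ω => (X₂ ω, Y₂ ω)) μ) :
    law μ (fun ω => ((X₁ ω, X₂ ω), (Y₁ ω, Y₂ ω))) =
      tensor (law μ fun ω => (X₁ ω, Y₁ ω)) (law μ fun ω => (X₂ ω, Y₂ ω)) := by
  funext z
  have := (indepFun_iff_law μ (hX₁.prodMk hY₁) (hX₂.prodMk hY₂)).1 h
    ((z.1.1, z.2.1), (z.1.2, z.2.2))
  rw [tensor, ← this]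
  simp only [law, pmfOf]
  congr 2
  ext ω
  simp only [Set.mem_preimage, Set.mem_singleton_iff, Prod.ext_iff]
  tauto

end RandomVariables

end RelAlpha

/-! ### Transfer from mass functions to random variables. -/

theorem theorem2
    {Ω 𝒳 𝒴 𝒳₁ 𝒳₂ 𝒴₁ 𝒴₂ : Type*} [MeasurableSpace Ω]
    [Fintype 𝒳] [MeasurableSpace 𝒳] [MeasurableSingletonClass 𝒳]
    [Fintype 𝒴] [MeasurableSpace 𝒴] [MeasurableSingletonClass 𝒴]
    [Fintype 𝒳₁] [MeasurableSpace 𝒳₁] [MeasurableSingletonClass 𝒳₁]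
    [Fintype 𝒳₂] [MeasurableSpace 𝒳₂] [MeasurableSingletonClass 𝒳₂]
    [Fintype 𝒴₁] [MeasurableSpace 𝒴₁] [MeasurableSingletonClass 𝒴₁]
    [Fintype 𝒴₂] [MeasurableSpace 𝒴₂] [MeasurableSingletonClass 𝒴₂]
    (μ : Measure Ω) [IsProbabilityMeasure μ]
    (X : Ω → 𝒳) (Y : Ω → 𝒴) (X₁ : Ω → 𝒳₁) (X₂ : Ω → 𝒳₂) (Y₁ : Ω → 𝒴₁) (Y₂ : Ω → 𝒴₂)
    (hX : Measurable X) (hY : Measurable Y) (hX₁ : Measurable X₁) (hX₂ : Measurable X₂)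
    (hY₁ : Measurable Y₁) (hY₂ : Measurable Y₂) :
    (∀ α : ℝ, 0 < α →
      -- the minimum defining `K_α(X;Y)` is attained
      (∃ (QX : PMF 𝒳) (QY : PMF 𝒴),
        RelAlpha.relAlphaEntropy α (RelAlpha.pmfOf μ (fun ω => (X ω, Y ω)))
          (RelAlpha.prodPmf QX QY) = RelAlpha.K μ α X Y) ∧
      -- nonnegativity
      0 ≤ RelAlpha.K μ α X Y ∧
      (RelAlpha.K μ α X Y = 0 ↔ IndepFun X Y μ) ∧
      -- symmetry
      RelAlpha.K μ α X Y = RelAlpha.K μ α Y X ∧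
      -- additivity
      (IndepFun (fun ω => (X₁ ω, Y₁ ω)) (fun ω => (X₂ ω, Y₂ ω)) μ →
        RelAlpha.K μ α (fun ω => (X₁ ω, X₂ ω)) (fun ω => (Y₁ ω, Y₂ ω))
          = RelAlpha.K μ α X₁ Y₁ + RelAlpha.K μ α X₂ Y₂) ∧
      -- upper bounds
      RelAlpha.K μ α X Y ≤ ((Real.log (Fintype.card 𝒳) : ℝ) : EReal) ∧
      RelAlpha.K μ α X Y ≤ ((Real.log (Fintype.card 𝒴) : ℝ) : EReal)) ∧
    -- order one
    RelAlpha.K μ 1 X Y = RelAlpha.mutualInfo μ X Y ∧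
    -- continuity in `α`
    ContinuousOn (fun α : ℝ => RelAlpha.K μ α X Y) (Set.Ioi 0) ∧
    -- closed forms of `K_α(X;X)`
    (∀ α : ℝ, 0 < α → α < 2 →
      RelAlpha.K μ α X X = ((2 * RelAlpha.renyiEntropy μ (α / (2 - α)) X
        - RelAlpha.renyiEntropy μ α X : ℝ) : EReal)) ∧
    (∀ α : ℝ, 2 ≤ α →
      RelAlpha.K μ α X X = ((α / (α - 1) * RelAlpha.minEntropy μ X
        - RelAlpha.renyiEntropy μ α X : ℝ) : EReal)) := by
  have hXY := (RelAlpha.law_mem μ (hX.prodMk hY)).1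
  have hYX := (RelAlpha.law_mem μ (hY.prodMk hX)).1
  have hpX := RelAlpha.law_mem μ hX
  have hpY := RelAlpha.law_mem μ hY
  have hsymm : ∀ α : ℝ, RelAlpha.K μ α X Y = RelAlpha.K μ α Y X := fun α => by
    rw [RelAlpha.K_eq_minDiv μ hX hY, RelAlpha.K_eq_minDiv μ hY hX, RelAlpha.law_swap μ X Y,
      RelAlpha.minDiv_swap]
  refine ⟨fun α hα => ⟨?_, ?_, ?_, hsymm α, ?_, ?_, ?_⟩, ?_, ?_, ?_, ?_⟩
  · obtain ⟨r, hr, t, ht, h⟩ := RelAlpha.exists_relAlphaEntropy_eq_minDiv hα hXY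
    obtain ⟨R, hR⟩ := RelAlpha.exists_pmf_eq_lift hr
    obtain ⟨T, hT⟩ := RelAlpha.exists_pmf_eq_lift ht
    exact ⟨R, T, by rw [RelAlpha.K_eq_minDiv μ hX hY, ← h, hR, hT, RelAlpha.prodPmf_lift hr.1,
      (RelAlpha.law_mem μ (hX.prodMk hY)).2]⟩
  · rw [RelAlpha.K_eq_minDiv μ hX hY]
    exact RelAlpha.minDiv_nonneg hα hXY
  · rw [RelAlpha.K_eq_minDiv μ hX hY, RelAlpha.minDiv_eq_zero_iff hα hXY,
      RelAlpha.indepFun_iff_law μ hX hY]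
    simp only [RelAlpha.law_fst μ hY, RelAlpha.law_snd μ hX]
  · intro hI
    rw [RelAlpha.K_eq_minDiv μ (hX₁.prodMk hX₂) (hY₁.prodMk hY₂), RelAlpha.K_eq_minDiv μ hX₁ hY₁,
      RelAlpha.K_eq_minDiv μ hX₂ hY₂, RelAlpha.law_tensor μ hX₁ hY₁ hX₂ hY₂ hI]
    exact RelAlpha.minDiv_tensor hα (RelAlpha.law_mem μ (hX₁.prodMk hY₁)).1
      (RelAlpha.law_mem μ (hX₂.prodMk hY₂)).1
  · rw [RelAlpha.K_eq_minDiv μ hX hY]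
    exact RelAlpha.minDiv_le_log_card hα hXY
  · rw [hsymm, RelAlpha.K_eq_minDiv μ hY hX]
    exact RelAlpha.minDiv_le_log_card hα hYX
  · have hmarg := RelAlpha.relAlphaEntropy_marginals hXY
    rw [RelAlpha.relAlphaEntropy, if_pos rfl, ← RelAlpha.minDiv_one hXY] at hmarg
    simp only [RelAlpha.law_fst μ hY, RelAlpha.law_snd μ hX] at hmarg
    rw [RelAlpha.K_eq_minDiv μ hX hY, ← hmarg, RelAlpha.mutualInfo, hpX.2, hpY.2,
      RelAlpha.prodPmf_lift hpX.1.1, (RelAlpha.law_mem μ (hX.prodMk hY)).2]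
  · simp_rw [RelAlpha.K_eq_minDiv μ hX hY]
    exact RelAlpha.continuousOn_minDiv hXY
  · intro α hα hα2
    rw [RelAlpha.K_eq_minDiv μ hX hX, RelAlpha.law_self]
    exact RelAlpha.minDiv_diag hα hα2 hpX.1
  · intro α hα
    rw [RelAlpha.K_eq_minDiv μ hX hX, RelAlpha.law_self]
    exact RelAlpha.minDiv_diag_of_two_le hα hpX.1
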